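/- All Hilbert spaces are complex, inner products are linear in the first argument, $\mathcal G^*$ denotes the anti-dual (bounded conjugate-linear functionals) of a Hilbert space $\mathcal G$ with its Hilbert space structure, and $\mathcal R_{\mathcal G}:\mathcal G\to\mathcal G^*$ the linear Riesz isomorphism. **Setting.** Let $\mathcal X,\mathcal Y$ be Hilbert spaces and $A:\mathcal X\supset\operatorname{dom}A\to\mathcal Y$ a closed densely defined operator such that the self-adjoint operator $S=A^*A$ is uniformly positive: $\langle Sx,x\rangle\ge c\|x\|^2$ on $\operatorname{dom}S$ for some $c>0$. Let $\mathcal X_h$ be $\operatorname{dom}A$ with inner product $\langle Ax,Ay\rangle_{\mathcal Y}$ (a Hilbert space), and $\mathcal Y_1=\operatorname{ran}A$. Let $B:\mathcal Y\supset\operatorname{dom}B\to\mathcal X$ be closed and densely defined with $A^*\subset -B$, and let $B_{\mathcal Y_1}$ be its restriction to $\operatorname{dom}B\cap\mathcal Y_1$. Let $\mathcal G_1,\mathcal G_2$ be Hilbert spaces and let $$\Lambda=\begin{bmatrix}\Lambda_1\\ \Lambda_2\end{bmatrix}:\operatorname{dom}A\to\begin{bmatrix}\mathcal G_1\\ \mathcal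 G_2^*\end{bmatrix},\qquad \Pi=\begin{bmatrix}\Pi_1\\ \Pi_2\end{bmatrix}:\operatorname{dom}B\to\begin{bmatrix}\mathcal G_1^*\\ \mathcal G_2\end{bmatrix}$$ be linear and surjective with $$-\langle By,x\rangle_{\mathcal X}-\langle y,Ax\rangle_{\mathcal Y}=\langle\Pi_1y,\Lambda_1x\rangle_{\mathcal G_1^*,\mathcal G_1}-\langle\Pi_2y,\Lambda_2x\rangle_{\mathcal G_2,\mathcal G_2^*}\qquad(y\in\operatorname{dom}B,\ x\in\operatorname{dom}A),$$ that is, a boundary triplet for the dual pair $(A^*,-B^*)$. Put $\mathcal G=\mathcal G_1\times\mathcal G_2$, identify $\mathcal G^*$ with $\mathcal G_1^*\times\mathcal G_2^*$, and define on $\operatorname{dom}\mathcal A=\{(z_1,z_2)\in\mathcal X_h\times\mathcal X_h: Az_1\in\operatorname{dom}B_{\mathcal Y_1}\}$ the maps $\Gamma_0:\operatorname{dom}\mathcal A\to\mathcal G$ and $\Gamma_1:\operatorname{dom}\mathcal A\to\mathcal G^*$, $$\Gamma_0z=(\Lambda_1z_2,\ \Pi_2Az_1),\qquad \Gamma_1z=(-\Pi_1Az_1,\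 \Lambda_2z_2).$$ Let $M\in L(\mathcal X)$ be self-adjoint and uniformly positive ($\langle Mx,x\rangle\ge\alpha\|x\|^2$ for some $\alpha>0$), let $\mathcal X_M$ be $\mathcal X$ with inner product $\langle M^{-1}x,y\rangle_{\mathcal X}$, and let $D\in L(\mathcal X)$ be such that $-D$ is dissipative ($\operatorname{Re}\langle Dx,x\rangle\ge0$). On the product Hilbert space $\mathcal X_h\times\mathcal X_M$ define $$\operatorname{dom}\mathcal A_M=\{(z_1,z_2)\in\mathcal X_h\times M\mathcal X_h: Az_1\in\operatorname{dom}B_{\mathcal Y_1}\},\qquad \mathcal A_M=\begin{bmatrix}0&M^{-1}\\ B_{\mathcal Y_1}A&-DM^{-1}\end{bmatrix}.$$ **Boundary nodes.** A colligation $\Theta=(G,L,K)$ on Hilbert spaces $(\mathcal U,\mathcal Z,\mathcal W)$ consists of linear maps $G,L,K$ from a common domain $\operatorname{dom}\Theta\subset\mathcal Z$ into $\mathcal U,\mathcal Z,\mathcal W$. It is a *boundary node* if the combined operator $(G,L,K)$ is closed, $G$ is surjective, $\ker G$ is dense in $\mathcal Z$, and the main operator $L|_{\ker G}$ has non-empty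 resolvent set; it is *internally well-posed* if moreover $L|_{\ker G}$ generates a strongly continuous semigroup on $\mathcal Z$. It is *scattering passive* if it is an internally well-posed boundary node and $$\tfrac{\mathrm d}{\mathrm dt}\|z(t)\|_{\mathcal Z}^2+\|y(t)\|_{\mathcal W}^2\le\|u(t)\|_{\mathcal U}^2\qquad(t\ge0)$$ for all $u\in C^2([0,\infty);\mathcal U)$ and $z\in C^1([0,\infty);\mathcal Z)\cap C([0,\infty);\operatorname{dom}\Theta)$, where $\operatorname{dom}\Theta$ carries the graph norm of $(G,L,K)$, with $u=Gz$, $\dot z=Lz$, $y=Kz$. If $\mathcal W=\mathcal U$, then $\Theta$ is *impedance passive* if for some $\beta\in\mathbb C$ with $\operatorname{Re}\beta>0$ the colligation $$\Big(\tfrac1{\sqrt{2\operatorname{Re}\beta}}(\beta G+K),\ L,\ \tfrac1{\sqrt{2\operatorname{Re}\beta}}(\overline\beta G-K)\Big)$$ with the same domain is a scattering passive boundary node. **Theorem.** Let $P\in L(\mathcal G^*)$ with $\|P\|\le1$. Then the colligation $$N=\begin{pmatrix}\tfrac12\big((1-P)\mathcal R_{\mathcal G}\Gamma_0+(1+P)\Gamma_1\big)\begin{bmatrix}I&0\\0&M^{-1}\end{bmatrix}\\[1mm]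 \mathcal A_M\\[1mm] \tfrac12\big((1+P)\mathcal R_{\mathcal G}\Gamma_0+(1-P)\Gamma_1\big)\begin{bmatrix}I&0\\0&M^{-1}\end{bmatrix}\end{pmatrix}$$ on $(\mathcal G^*,\ \mathcal X_h\times\mathcal X_M,\ \mathcal G^*)$ with domain $\operatorname{dom}N=\operatorname{dom}\mathcal A_M$ is an impedance passive, internally well-posed boundary node. -/

import Mathlib

open scoped InnerProductSpace
open Set Filter Topology

noncomputable section

namespace PHNode

/-! ### Anti-duals and the Riesz isomorphism -/

section AntiDual

variable {E : Type*} [NormedAddCommGroup E] [InnerProductSpace ℂ E] [CompleteSpace E]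

/-- The anti-dual: bounded conjugate-linear functionals, with the operator norm. -/
abbrev AntiDual (E : Type*) [NormedAddCommGroup E] [InnerProductSpace ℂ E] : Type _ :=
  E →L⋆[ℂ] ℂ

/-- The (linear, isometric) Riesz isomorphism `x ↦ ⟨x, ·⟩` onto the anti-dual, the inner product
being linear in `x`; in Mathlib's convention `riesz x y = ⟪y, x⟫`. -/
def riesz (E : Type*) [NormedAddCommGroup E] [InnerProductSpace ℂ E] [CompleteSpace E] :
    E ≃ₗᵢ[ℂ] AntiDual E :=
  LinearIsometryEquiv.ofSurjective
    { toLinearMap := ((innerSLFlip ℂ : E →L[ℂ] E →L⋆[ℂ] ℂ) : E →ₗ[ℂ] E →L⋆[ℂ] ℂ)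
      norm_map' := by
        intro x
        apply le_antisymm
        · refine ContinuousLinearMap.opNorm_le_bound _ (norm_nonneg _) fun y => ?_
          simp only [ContinuousLinearMap.coe_coe, innerSLFlip_apply_apply]
          rw [mul_comm]
          exact norm_inner_le_norm y x
        · by_cases hx : x = 0
          · simp [hx]
          · have h := ContinuousLinearMap.le_opNorm (innerSLFlip ℂ x) x
            rw [innerSLFlip_apply_apply, inner_self_eq_norm_sq_to_K, norm_pow, RCLike.norm_ofReal,
              abs_norm, pow_two] at h
            exact le_of_mul_le_mul_right h (norm_pos_iff.mpr hx) }
    (by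
      intro f
      let g : StrongDual ℂ E := ((starL ℂ : ℂ ≃L⋆[ℂ] ℂ) : ℂ →L⋆[ℂ] ℂ).comp f
      refine ⟨(InnerProductSpace.toDual ℂ E).symm g, ?_⟩
      ext y
      have h : ⟪(InnerProductSpace.toDual ℂ E).symm g, y⟫_ℂ = g y :=
        InnerProductSpace.toDual_symm_apply
      change ⟪y, (InnerProductSpace.toDual ℂ E).symm g⟫_ℂ = f y
      rw [← inner_conj_symm, h]
      simp [g])

@[simp] theorem riesz_apply (x y : E) : riesz E x y = ⟪y, x⟫_ℂ := rfl

/-- The Hilbert space structure of the anti-dual that makes the Riesz isomorphism unitary; its norm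
is the operator norm. -/
instance instInnerProductSpaceAntiDual : InnerProductSpace ℂ (E →L⋆[ℂ] ℂ) where
  inner f g := ⟪(riesz E).symm f, (riesz E).symm g⟫_ℂ
  norm_sq_eq_re_inner f := by
    rw [← (riesz E).symm.norm_map f]
    exact norm_sq_eq_re_inner _
  conj_inner_symm f g := inner_conj_symm _ _
  add_left f g k := by simp
  smul_left f g c := by simp [mul_comm]

/-- The identification of `E₁* × E₂*` with `(E₁ × E₂)*`. -/
def antiDualProd (E₁ E₂ : Type*) [NormedAddCommGroup E₁] [InnerProductSpace ℂ E₁]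
    [NormedAddCommGroup E₂] [InnerProductSpace ℂ E₂] :
    (AntiDual E₁ × AntiDual E₂) →ₗ[ℂ] AntiDual (WithLp 2 (E₁ × E₂)) where
  toFun f := f.1.comp (WithLp.fstL 2 ℂ E₁ E₂) + f.2.comp (WithLp.sndL 2 ℂ E₁ E₂)
  map_add' f g := by
    ext z
    simp only [Prod.fst_add, Prod.snd_add, ContinuousLinearMap.add_comp, add_apply]
    abel
  map_smul' c f := by
    ext z
    simp

end AntiDual

/-! ### Strongly continuous semigroups -/

section Semigroup

variable {X : Type*} [NormedAddCommGroup X] [InnerProductSpace ℂ X]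

/-- A strongly continuous one-parameter semigroup of bounded operators. -/
structure IsC0Semigroup (T : NNReal → X →L[ℂ] X) : Prop where
  zero : T 0 = 1
  add : ∀ s t, T (s + t) = T s * T t
  continuous : ∀ x, Continuous fun t => T t x

/-- `A` is the infinitesimal generator of `T`: `x ∈ dom A` and `A x = y` if and only if
`(T t x - x) / t → y` as `t ↓ 0`. -/
def IsGeneratorOf (A : X →ₗ.[ℂ] X) (T : NNReal → X →L[ℂ] X) : Prop :=
  ∀ x y : X, (x, y) ∈ A.graph ↔
    Tendsto (fun t : NNReal => ((t : ℝ)⁻¹ : ℂ) • (T t x - x)) (𝓝[>] 0) (𝓝 y)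

/-- `A` generates a strongly continuous semigroup. -/
def GeneratesC0Semigroup (A : X →ₗ.[ℂ] X) : Prop :=
  ∃ T : NNReal → X →L[ℂ] X, IsC0Semigroup T ∧ IsGeneratorOf A T

/-- `μ` lies in the resolvent set of `A`: `μ - A : dom A → X` has a bounded, everywhere defined
inverse `R`. -/
def InResolventSet (A : X →ₗ.[ℂ] X) (μ : ℂ) : Prop :=
  ∃ R : X →L[ℂ] X,
    (∀ x : X, ∃ h : R x ∈ A.domain, μ • R x - A ⟨R x, h⟩ = x) ∧
    ∀ x : A.domain, R (μ • (x : X) - A x) = x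

end Semigroup

/-! ### Boundary nodes -/

/-- A colligation with input space `U`, state space `X` and output space `Y`. -/
structure Colligation (U X Y : Type*)
    [NormedAddCommGroup U] [InnerProductSpace ℂ U] [CompleteSpace U]
    [NormedAddCommGroup X] [InnerProductSpace ℂ X] [CompleteSpace X]
    [NormedAddCommGroup Y] [InnerProductSpace ℂ Y] [CompleteSpace Y] where
  dom : Submodule ℂ X
  G : dom →ₗ[ℂ] U
  L : dom →ₗ[ℂ] X
  K : dom →ₗ[ℂ] Y

namespace Colligation

variable {U X Y : Type*}
  [NormedAddCommGroup U] [InnerProductSpace ℂ U] [CompleteSpace U]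
  [NormedAddCommGroup X] [InnerProductSpace ℂ X] [CompleteSpace X]
  [NormedAddCommGroup Y] [InnerProductSpace ℂ Y] [CompleteSpace Y]

/-- The combined operator `(G, L, K)`. -/
def combined (Θ : Colligation U X Y) : X →ₗ.[ℂ] (U × X × Y) where
  domain := Θ.dom
  toFun := Θ.G.prod (Θ.L.prod Θ.K)

/-- The kernel of the input operator, as a subspace of the state space. -/
def kerG (Θ : Colligation U X Y) : Submodule ℂ X :=
  (LinearMap.ker Θ.G).map Θ.dom.subtype

/-- The main operator: the restriction of `L` to `ker G`. -/
def mainOperator (Θ : Colligation U X Y) : X →ₗ.[ℂ] X :=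
  (LinearPMap.mk Θ.dom Θ.L).domRestrict Θ.kerG

/-- Boundary nodes. -/
structure IsBoundaryNode (Θ : Colligation U X Y) : Prop where
  closed : Θ.combined.IsClosed
  surjective : Function.Surjective Θ.G
  dense_ker : Dense (Θ.kerG : Set X)
  resolvent_nonempty : ∃ μ : ℂ, InResolventSet Θ.mainOperator μ

/-- Internally well-posed boundary nodes (in the forward time direction). -/
def IsInternallyWellPosed (Θ : Colligation U X Y) : Prop :=
  Θ.IsBoundaryNode ∧ GeneratesC0Semigroup Θ.mainOperator

/-- Smooth solutions on `[0, ∞)` of `u = G z`, `z' = L z`, `y = K z`: the input `u` is `C²`, and `z`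
is `C¹` into the state space and continuous into `dom Θ` with the graph norm of `(G, L, K)`. Only
the values at times `t ≥ 0` matter. -/
structure IsSmoothSolution (Θ : Colligation U X Y) (u : ℝ → U) (z : ℝ → Θ.dom) (y : ℝ → Y) :
    Prop where
  input_smooth : ContDiffOn ℝ 2 u (Ici 0)
  state_smooth : ContDiffOn ℝ 1 (fun t => (z t : X)) (Ici 0)
  continuous_graph : ContinuousOn (fun t => ((z t : X), Θ.G (z t), Θ.L (z t), Θ.K (z t))) (Ici 0)
  input_eq : ∀ t, 0 ≤ t → u t = Θ.G (z t)
  state_eq : ∀ t, 0 ≤ t → HasDerivWithinAt (fun s => (z s : X)) (Θ.L (z t)) (Ici 0) t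
  output_eq : ∀ t, 0 ≤ t → y t = Θ.K (z t)

/-- Scattering passive boundary nodes. -/
def IsScatteringPassive (Θ : Colligation U X Y) : Prop :=
  Θ.IsInternallyWellPosed ∧
    ∀ (u : ℝ → U) (z : ℝ → Θ.dom) (y : ℝ → Y), Θ.IsSmoothSolution u z y →
      ∀ t, 0 ≤ t →
        derivWithin (fun s => ‖(z s : X)‖ ^ 2) (Ici 0) t + ‖y t‖ ^ 2 ≤ ‖u t‖ ^ 2

/-- The external Cayley transform with parameter `β`, `Re β > 0`. -/
def externalCayley (Θ : Colligation U X U) (β : ℂ) : Colligation U X U where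
  dom := Θ.dom
  G := ((1 / Real.sqrt (2 * β.re) : ℝ) : ℂ) • (β • Θ.G + Θ.K)
  L := Θ.L
  K := ((1 / Real.sqrt (2 * β.re) : ℝ) : ℂ) • ((starRingEnd ℂ) β • Θ.G - Θ.K)

/-- Impedance passivity. -/
def IsImpedancePassive (Θ : Colligation U X U) : Prop :=
  ∃ β : ℂ, 0 < β.re ∧ (Θ.externalCayley β).IsScatteringPassive

end Colligation

/-! ### Stiffness, energy space, mass and damping -/

section SecondOrder

open scoped LinearPMap

variable {X Y : Type*} [NormedAddCommGroup X] [InnerProductSpace ℂ X] [CompleteSpace X]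
  [NormedAddCommGroup Y] [InnerProductSpace ℂ Y] [CompleteSpace Y]

/-- The operator `S = A* A` on its natural domain `{x ∈ dom A | A x ∈ dom A*}`. -/
def stiffness (A : X →ₗ.[ℂ] Y) : X →ₗ.[ℂ] X where
  domain :=
    { carrier := {x | ∃ h : x ∈ A.domain, A ⟨x, h⟩ ∈ A†.domain}
      add_mem' := by
        rintro x y ⟨hx, hx'⟩ ⟨hy, hy'⟩
        refine ⟨A.domain.add_mem hx hy, ?_⟩
        have : A ⟨x + y, A.domain.add_mem hx hy⟩ = A ⟨x, hx⟩ + A ⟨y, hy⟩ :=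
          A.map_add ⟨x, hx⟩ ⟨y, hy⟩
        rw [this]
        exact A†.domain.add_mem hx' hy'
      zero_mem' := by
        refine ⟨A.domain.zero_mem, ?_⟩
        have : A ⟨0, A.domain.zero_mem⟩ = 0 := A.map_zero
        rw [this]
        exact A†.domain.zero_mem
      smul_mem' := by
        rintro c x ⟨hx, hx'⟩
        refine ⟨A.domain.smul_mem c hx, ?_⟩
        have : A ⟨c • x, A.domain.smul_mem c hx⟩ = c • A ⟨x, hx⟩ := A.map_smul c ⟨x, hx⟩
        rw [this]
        exact A†.domain.smul_mem c hx' }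
  toFun :=
    { toFun := fun x => A† ⟨A ⟨x, x.2.fst⟩, x.2.snd⟩
      map_add' := by
        intro x y
        rw [← A†.map_add]
        congr 1
        exact Subtype.ext (A.map_add ⟨x, x.2.fst⟩ ⟨y, y.2.fst⟩)
      map_smul' := by
        intro c x
        rw [RingHom.id_apply, ← A†.map_smul]
        congr 1
        exact Subtype.ext (A.map_smul c ⟨x, x.2.fst⟩) }

/-- `A` is a closed, densely defined operator for which `S = A* A` (which is then automatically
self-adjoint) is uniformly positive. -/
structure IsStiffnessFactor (A : X →ₗ.[ℂ] Y) : Prop where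
  closed : A.IsClosed
  dense : Dense (A.domain : Set X)
  uniformly_positive : ∃ c : ℝ, 0 < c ∧
    ∀ x : (stiffness A).domain, c * ‖(x : X)‖ ^ 2 ≤ (⟪stiffness A x, (x : X)⟫_ℂ).re

/-- `M` is a bounded, self-adjoint and uniformly positive operator. -/
structure IsMassOperator (M : X →L[ℂ] X) : Prop where
  selfAdjoint : IsSelfAdjoint M
  uniformly_positive : ∃ α : ℝ, 0 < α ∧ ∀ x : X, α * ‖x‖ ^ 2 ≤ (⟪M x, x⟫_ℂ).re

/-- Dissipativity of a bounded operator. -/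
def IsDissipative (T : X →L[ℂ] X) : Prop := ∀ x : X, (⟪x, T x⟫_ℂ).re ≤ 0

/-- The lower bound of `A* A` passes to the form `‖A x‖²` on all of `dom A`, because `dom (A* A)` is
a core of `A`. -/
theorem IsStiffnessFactor.lower_bound {A : X →ₗ.[ℂ] Y} (hA : IsStiffnessFactor A) :
    ∃ c : ℝ, 0 < c ∧ ∀ x : A.domain, c * ‖(x : X)‖ ^ 2 ≤ ‖A x‖ ^ 2 := by
  obtain ⟨c, hc, hS⟩ := hA.uniformly_positive
  refine ⟨c, hc, ?_⟩
  let p : Submodule ℂ (WithLp 2 (X × Y)) :=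
    A.graph.comap (WithLp.linearEquiv 2 ℂ (X × Y)).toLinearMap
  have hp : IsClosed (p : Set (WithLp 2 (X × Y))) :=
    IsClosed.preimage (WithLp.prod_continuous_ofLp 2 X Y) hA.closed
  have hpm : ∀ a : A.domain, WithLp.toLp 2 ((a : X), A a) ∈ p := fun a => A.mem_graph a
  have : CompleteSpace p := hp.completeSpace_coe
  let D : Submodule ℂ p :=
    ((stiffness A).domain.comap (WithLp.fstL 2 ℂ X Y).toLinearMap).comap p.subtype
  have hD : Dᗮ = ⊥ := by
    rw [Submodule.eq_bot_iff]
    rintro ⟨w, hw⟩ hwD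
    obtain ⟨x, hx1, hx2⟩ := A.mem_graph_iff.mp hw
    let v := p.orthogonalProjectionOnto (WithLp.toLp 2 ((x : X), (0 : Y)))
    have hv : ∀ q ∈ p, ⟪q, WithLp.toLp 2 ((x : X), (0 : Y)) - v⟫_ℂ = 0 :=
      fun q hq => by
        have h := p.inner_orthogonalProjectionOnto_eq_of_mem_right ⟨q, hq⟩
          (WithLp.toLp 2 ((x : X), (0 : Y)))
        rw [inner_sub_right, sub_eq_zero]
        exact (inner_conj_symm _ _).symm.trans ((congrArg _ h.symm).trans (inner_conj_symm _ _))
    obtain ⟨u, hu1, hu2⟩ := A.mem_graph_iff.mp v.2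
    have hu1' : (u : X) = (v : WithLp 2 (X × Y)).fst := hu1
    have hu2' : A u = (v : WithLp 2 (X × Y)).snd := hu2
    have hadj : A u ∈ A†.domain := by
      refine LinearPMap.mem_adjoint_domain_of_exists _ ⟨(x : X) - u, fun a => ?_⟩
      have h := hv _ (hpm a)
      change ⟪(a : X), (x : X) - (v : WithLp 2 (X × Y)).fst⟫_ℂ
        + ⟪A a, (0 : Y) - (v : WithLp 2 (X × Y)).snd⟫_ℂ = 0 at h
      rw [← hu1', ← hu2', zero_sub, inner_neg_right] at h
      rw [← inner_conj_symm, ← inner_conj_symm (A u)]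
      congr 1
      linear_combination h
    have hvD : v ∈ D := by
      change (v : WithLp 2 (X × Y)).fst ∈ (stiffness A).domain
      rw [← hu1']
      exact ⟨u.2, hadj⟩
    have h1 : ⟪(v : WithLp 2 (X × Y)), w⟫_ℂ = 0 := hwD v hvD
    have h2 : ⟪w, WithLp.toLp 2 ((x : X), (0 : Y))⟫_ℂ = 0 := by
      have h := hv w hw
      rw [inner_sub_right, ← inner_conj_symm w v, h1, map_zero, sub_zero] at h
      exact h
    have hx1' : (x : X) = w.fst := hx1
    have hx2' : A x = w.snd := hx2
    have h3 : ⟪(x : X), (x : X)⟫_ℂ = 0 := by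
      change ⟪w.fst, (x : X)⟫_ℂ + ⟪w.snd, (0 : Y)⟫_ℂ = 0 at h2
      rwa [← hx1', inner_zero_right, add_zero] at h2
    have hx0 : x = 0 := Subtype.ext (inner_self_eq_zero.mp h3)
    have hw1 : w.fst = 0 := by rw [← hx1', hx0]; rfl
    have hw2 : w.snd = 0 := by rw [← hx2', hx0]; exact A.map_zero
    apply Subtype.ext
    change w = 0
    exact (WithLp.equiv 2 (X × Y)).injective (Prod.ext hw1 hw2)
  have hdense : Dense (D : Set p) := by
    rw [Submodule.dense_iff_topologicalClosure_eq_top, Submodule.topologicalClosure_eq_top_iff]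
    exact hD
  have hall : ∀ q : p, c * ‖(q : WithLp 2 (X × Y)).fst‖ ^ 2 ≤
      ‖(q : WithLp 2 (X × Y)).snd‖ ^ 2 := by
    have hf : Continuous fun q : p => (q : WithLp 2 (X × Y)).fst :=
      (WithLp.fstL 2 ℂ X Y).continuous.comp continuous_subtype_val
    have hs : Continuous fun q : p => (q : WithLp 2 (X × Y)).snd :=
      (WithLp.sndL 2 ℂ X Y).continuous.comp continuous_subtype_val
    have hcl : IsClosed {q : p | c * ‖(q : WithLp 2 (X × Y)).fst‖ ^ 2 ≤
        ‖(q : WithLp 2 (X × Y)).snd‖ ^ 2} :=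
      isClosed_le (continuous_const.mul (hf.norm.pow 2)) (hs.norm.pow 2)
    intro q
    refine hcl.closure_subset_iff.mpr ?_ (hdense q)
    rintro ⟨w, hw⟩ hwD
    obtain ⟨u, hu1, hu2⟩ := A.mem_graph_iff.mp hw
    have hu1' : (u : X) = w.fst := hu1
    have hu2' : A u = w.snd := hu2
    have hwD' : w.fst ∈ (stiffness A).domain := hwD
    rw [← hu1'] at hwD'
    obtain ⟨h, hadj⟩ := hwD'
    have hb := hS ⟨u, ⟨h, hadj⟩⟩
    have hfa : ⟪stiffness A ⟨u, ⟨h, hadj⟩⟩, (u : X)⟫_ℂ = ⟪A u, A u⟫_ℂ :=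
      A.adjoint_isFormalAdjoint hA.dense ⟨A u, hadj⟩ u
    change c * ‖w.fst‖ ^ 2 ≤ ‖w.snd‖ ^ 2
    rw [← hu1', ← hu2']
    refine hb.trans_eq ?_
    change (⟪stiffness A ⟨u, ⟨h, hadj⟩⟩, (u : X)⟫_ℂ).re = _
    rw [hfa]
    exact (norm_sq_eq_re_inner (𝕜 := ℂ) (A u)).symm
  exact fun x => hall ⟨_, hpm x⟩

theorem IsStiffnessFactor.injective {A : X →ₗ.[ℂ] Y} (hA : IsStiffnessFactor A) :
    Function.Injective A.toFun := by
  obtain ⟨c, hc, h⟩ := hA.lower_bound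
  rw [← LinearMap.ker_eq_bot, LinearMap.ker_eq_bot']
  intro x hx
  have h1 := h x
  rw [show A x = 0 from hx, norm_zero] at h1
  have h2 : ‖(x : X)‖ ^ 2 ≤ 0 := by nlinarith
  exact Subtype.ext (norm_eq_zero.mp (pow_eq_zero_iff two_ne_zero |>.mp (le_antisymm h2 (by positivity))))

/-- The energy space `X_h`: the vector space `dom A` with inner product `⟨A x, A y⟩`. -/
def EnergySpace {A : X →ₗ.[ℂ] Y} (_ : IsStiffnessFactor A) : Type _ := A.domain

namespace EnergySpace

variable {A : X →ₗ.[ℂ] Y} (hA : IsStiffnessFactor A)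

instance : AddCommGroup (EnergySpace hA) := inferInstanceAs (AddCommGroup A.domain)
instance : Module ℂ (EnergySpace hA) := inferInstanceAs (Module ℂ A.domain)

/-- The identity map to `dom A`. -/
def toDomain : EnergySpace hA ≃ₗ[ℂ] A.domain := LinearEquiv.refl ℂ A.domain

/-- `A` as a linear map on the energy space. -/
def map : EnergySpace hA →ₗ[ℂ] Y := A.toFun ∘ₗ (toDomain hA).toLinearMap

theorem map_injective : Function.Injective (map hA) :=
  hA.injective.comp (toDomain hA).injective

instance : NormedAddCommGroup (EnergySpace hA) :=
  NormedAddCommGroup.induced (EnergySpace hA) Y (map hA) (map_injective hA)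

instance : InnerProductSpace ℂ (EnergySpace hA) where
  norm_smul_le c x := by
    change ‖map hA (c • x)‖ ≤ ‖c‖ * ‖map hA x‖
    rw [map_smul, norm_smul]
  inner x y := ⟪map hA x, map hA y⟫_ℂ
  norm_sq_eq_re_inner x := norm_sq_eq_re_inner (𝕜 := ℂ) (map hA x)
  conj_inner_symm x y := inner_conj_symm _ _
  add_left x y z := by simp
  smul_left x y c := by simp [mul_comm]

theorem norm_def (x : EnergySpace hA) : ‖x‖ = ‖map hA x‖ := rfl

theorem inner_def (x y : EnergySpace hA) : ⟪x, y⟫_ℂ = ⟪map hA x, map hA y⟫_ℂ := rfl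

instance : CompleteSpace (EnergySpace hA) := by
  have hiso : Isometry (map hA) := AddMonoidHomClass.isometry_of_norm (map hA) fun _ => rfl
  rw [completeSpace_iff_isComplete_range hiso.isUniformInducing]
  apply IsClosed.isComplete
  rw [← closure_subset_iff_isClosed]
  intro y hy
  obtain ⟨f, hf, hlim⟩ := mem_closure_iff_seq_limit.mp hy
  choose x hx using hf
  obtain ⟨c, hc, hb⟩ := hA.lower_bound
  have hcau : CauchySeq fun n => ((toDomain hA (x n) : A.domain) : X) := by
    have hfc : CauchySeq f := hlim.cauchySeq
    rw [Metric.cauchySeq_iff] at hfc ⊢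
    intro ε hε
    obtain ⟨N, hN⟩ := hfc (Real.sqrt c * ε) (by positivity)
    refine ⟨N, fun m hm n hn => ?_⟩
    have h1 := hN m hm n hn
    rw [dist_eq_norm, ← hx, ← hx, ← map_sub] at h1
    have h2 := hb (toDomain hA (x m - x n))
    have h3 : ‖A (toDomain hA (x m - x n))‖ ^ 2 < (Real.sqrt c * ε) ^ 2 :=
      pow_lt_pow_left₀ h1 (norm_nonneg _) two_ne_zero
    rw [mul_pow, Real.sq_sqrt hc.le] at h3
    have h4 := lt_of_mul_lt_mul_left (h2.trans_lt h3) hc.le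
    rw [dist_eq_norm]
    refine lt_of_pow_lt_pow_left₀ 2 hε.le ?_
    simpa using h4
  obtain ⟨x₀, hx₀⟩ := cauchySeq_tendsto_of_complete hcau
  have hg : (x₀, y) ∈ A.graph := by
    refine hA.closed.mem_of_tendsto (hx₀.prodMk_nhds hlim) (Eventually.of_forall fun n => ?_)
    rw [← hx n]
    exact A.mem_graph (toDomain hA (x n))
  obtain ⟨u, -, hu⟩ := A.mem_graph_iff.mp hg
  exact ⟨(toDomain hA).symm u, hu⟩

end EnergySpace

/-- A mass operator is invertible. -/
theorem IsMassOperator.isUnit {M : X →L[ℂ] X} (hM : IsMassOperator M) : IsUnit M := by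
  obtain ⟨α, hα, h⟩ := hM.uniformly_positive
  refine ContinuousLinearMap.isUnit_of_forall_le_norm_inner_map M (c := ⟨α, hα.le⟩) hα fun x => ?_
  rw [mul_comm]
  exact (h x).trans (Complex.re_le_norm _)

/-- The inverse `M⁻¹` of a mass operator. -/
def IsMassOperator.inv {M : X →L[ℂ] X} (_ : IsMassOperator M) : X →L[ℂ] X := Ring.inverse M

namespace IsMassOperator

variable {M : X →L[ℂ] X}

@[simp] theorem apply_inv (hM : IsMassOperator M) (x : X) : M (hM.inv x) = x :=
  DFunLike.congr_fun (Ring.mul_inverse_cancel M hM.isUnit) x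

@[simp] theorem inv_apply (hM : IsMassOperator M) (x : X) : hM.inv (M x) = x :=
  DFunLike.congr_fun (Ring.inverse_mul_cancel M hM.isUnit) x

theorem inner_inv (hM : IsMassOperator M) (x y : X) : ⟪hM.inv x, y⟫_ℂ = ⟪x, hM.inv y⟫_ℂ := by
  have h := hM.selfAdjoint.isSymmetric (hM.inv x) (hM.inv y)
  simpa using h.symm

theorem inv_coercive (hM : IsMassOperator M) :
    ∃ β : ℝ, 0 < β ∧ ∀ x : X, β * ‖x‖ ^ 2 ≤ (⟪hM.inv x, x⟫_ℂ).re := by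
  obtain ⟨α, hα, h⟩ := hM.uniformly_positive
  refine ⟨α / (‖M‖ + 1) ^ 2, by positivity, fun x => ?_⟩
  have h1 := h (hM.inv x)
  rw [hM.apply_inv, ← hM.inner_inv] at h1
  refine le_trans ?_ h1
  have h2 : ‖x‖ ≤ (‖M‖ + 1) * ‖hM.inv x‖ := by
    calc ‖x‖ = ‖M (hM.inv x)‖ := by rw [hM.apply_inv]
      _ ≤ ‖M‖ * ‖hM.inv x‖ := M.le_opNorm _
      _ ≤ _ := by nlinarith [norm_nonneg (hM.inv x)]
  have h3 : ‖x‖ ^ 2 ≤ ((‖M‖ + 1) * ‖hM.inv x‖) ^ 2 := pow_le_pow_left₀ (norm_nonneg _) h2 2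
  rw [div_mul_eq_mul_div, div_le_iff₀ (by positivity)]
  calc α * ‖x‖ ^ 2 ≤ α * ((‖M‖ + 1) * ‖hM.inv x‖) ^ 2 := by gcongr
    _ = _ := by ring

end IsMassOperator

/-- The space `X_M`: the vector space `X` with inner product `⟨M⁻¹ x, y⟩`. -/
def WeightedSpace {M : X →L[ℂ] X} (_ : IsMassOperator M) : Type _ := X

namespace WeightedSpace

variable {M : X →L[ℂ] X} (hM : IsMassOperator M)

instance : AddCommGroup (WeightedSpace hM) := inferInstanceAs (AddCommGroup X)
instance : Module ℂ (WeightedSpace hM) := inferInstanceAs (Module ℂ X)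

/-- The identity map to `X`. -/
def toX : WeightedSpace hM ≃ₗ[ℂ] X := LinearEquiv.refl ℂ X

/-- The weighted inner product. -/
abbrev core : InnerProductSpace.Core ℂ (WeightedSpace hM) where
  inner x y := ⟪hM.inv (toX hM x), toX hM y⟫_ℂ
  conj_inner_symm x y := by
    rw [inner_conj_symm, hM.inner_inv]
  re_inner_nonneg x := by
    obtain ⟨β, hβ, h⟩ := hM.inv_coercive
    exact le_trans (by positivity) (h (toX hM x))
  add_left x y z := by simp
  smul_left x y c := by simp [mul_comm]
  definite x hx := by
    obtain ⟨β, hβ, h⟩ := hM.inv_coercive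
    have h1 := h (toX hM x)
    rw [hx, Complex.zero_re] at h1
    have h2 : ‖toX hM x‖ ^ 2 ≤ 0 := by nlinarith
    have h3 : toX hM x = 0 :=
      norm_eq_zero.mp (pow_eq_zero_iff two_ne_zero |>.mp (le_antisymm h2 (by positivity)))
    exact (toX hM).map_eq_zero_iff.mp h3

instance : NormedAddCommGroup (WeightedSpace hM) :=
  @InnerProductSpace.Core.toNormedAddCommGroup ℂ _ _ _ _ (core hM)

instance : InnerProductSpace ℂ (WeightedSpace hM) :=
  InnerProductSpace.ofCore (core hM).toCore

theorem inner_def (x y : WeightedSpace hM) : ⟪x, y⟫_ℂ = ⟪hM.inv (toX hM x), toX hM y⟫_ℂ := rfl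

theorem norm_sq_def (x : WeightedSpace hM) : ‖x‖ ^ 2 = (⟪hM.inv (toX hM x), toX hM x⟫_ℂ).re :=
  norm_sq_eq_re_inner (𝕜 := ℂ) x

instance : CompleteSpace (WeightedSpace hM) := by
  obtain ⟨β, hβ, h⟩ := hM.inv_coercive
  have h1 : ∀ x, ‖toX hM x‖ ≤ (Real.sqrt β)⁻¹ * ‖x‖ := by
    intro x
    have h2 := h (toX hM x)
    rw [← norm_sq_def] at h2
    rw [← div_eq_inv_mul, le_div_iff₀ (by positivity)]
    refine le_of_sq_le_sq ?_ (norm_nonneg _)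
    rw [mul_pow, Real.sq_sqrt hβ.le]
    linarith
  have h3 : ∀ x, ‖(toX hM).symm x‖ ≤ Real.sqrt ‖hM.inv‖ * ‖x‖ := by
    intro x
    refine le_of_sq_le_sq ?_ (by positivity)
    rw [norm_sq_def, mul_pow, Real.sq_sqrt (norm_nonneg _), LinearEquiv.apply_symm_apply]
    calc (⟪hM.inv x, x⟫_ℂ).re ≤ ‖⟪hM.inv x, x⟫_ℂ‖ := Complex.re_le_norm _
      _ ≤ ‖hM.inv x‖ * ‖x‖ := norm_inner_le_norm _ _
      _ ≤ ‖hM.inv‖ * ‖x‖ * ‖x‖ := by gcongr; exact hM.inv.le_opNorm x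
      _ = _ := by ring
  let e : WeightedSpace hM ≃L[ℂ] X := (toX hM).toContinuousLinearEquivOfBounds _ _ h1 h3
  exact (completeSpace_congr (e := e.toEquiv) e.isUniformEmbedding).mpr inferInstance

end WeightedSpace

/-! ### The block operator with boundary maps -/

/-- The restriction `B_{Y₁}` of `B` to `Y₁ = ran A`, with domain `dom B ∩ Y₁`. -/
def restrictRange (A : X →ₗ.[ℂ] Y) (B : Y →ₗ.[ℂ] X) : LinearMap.range A.toFun →ₗ.[ℂ] X where
  domain := B.domain.comap (LinearMap.range A.toFun).subtype
  toFun := B.toFun ∘ₗ (LinearMap.range A.toFun).subtype.restrict fun _ hy => hy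

variable {G₁ G₂ : Type*} [NormedAddCommGroup G₁] [InnerProductSpace ℂ G₁] [CompleteSpace G₁]
  [NormedAddCommGroup G₂] [InnerProductSpace ℂ G₂] [CompleteSpace G₂]

/-- `(G₁ × G₂, Λ, Π)` is a boundary triplet for the dual pair `(A*, -B*)`, where `A` and `B` are
closed and densely defined, so that `dom (A*)* = dom A` and `dom (-B*)* = dom B`. Inner products
`⟨x, y⟩` that are linear in `x` are `⟪y, x⟫` in Mathlib's convention; the pairing of `f ∈ G*` and
`g ∈ G` is `⟨f, g⟩ = f g`, and `⟨g, f⟩` is its complex conjugate. -/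
structure IsDualPairBoundaryTriplet (A : X →ₗ.[ℂ] Y) (B : Y →ₗ.[ℂ] X)
    (Lam : A.domain →ₗ[ℂ] G₁ × AntiDual G₂) (Pi : B.domain →ₗ[ℂ] AntiDual G₁ × G₂) : Prop where
  surjective_left : Function.Surjective Lam
  surjective_right : Function.Surjective Pi
  green : ∀ (y : B.domain) (x : A.domain),
    -⟪(x : X), B y⟫_ℂ - ⟪A x, (y : Y)⟫_ℂ =
      (Pi y).1 (Lam x).1 - (starRingEnd ℂ) ((Lam x).2 (Pi y).2)

variable {A : X →ₗ.[ℂ] Y} {M : X →L[ℂ] X}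

/-- The domain of `𝒜`: all `(z₁, z₂) ∈ X_h × X_h` with `A z₁ ∈ dom B_{Y₁}`, as a subspace of
`X_h × X`. -/
def blockDomain (hA : IsStiffnessFactor A) (B : Y →ₗ.[ℂ] X) :
    Submodule ℂ (WithLp 2 (EnergySpace hA × X)) :=
  ((restrictRange A B).domain.comap (A.toFun.rangeRestrict ∘ₗ
      (EnergySpace.toDomain hA).toLinearMap ∘ₗ (WithLp.fstL 2 ℂ (EnergySpace hA) X).toLinearMap)) ⊓
    A.domain.comap (WithLp.sndL 2 ℂ (EnergySpace hA) X).toLinearMap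

/-- The map `z ↦ A z₁` from `dom 𝒜` to `dom B_{Y₁}`. -/
def strain (hA : IsStiffnessFactor A) (B : Y →ₗ.[ℂ] X) :
    blockDomain hA B →ₗ[ℂ] (restrictRange A B).domain :=
  (A.toFun.rangeRestrict ∘ₗ (EnergySpace.toDomain hA).toLinearMap ∘ₗ
    (WithLp.fstL 2 ℂ (EnergySpace hA) X).toLinearMap).restrict fun _ hz => hz.1

/-- The map `z ↦ A z₁` from `dom 𝒜` to `dom B`. -/
def strainB (hA : IsStiffnessFactor A) (B : Y →ₗ.[ℂ] X) : blockDomain hA B →ₗ[ℂ] B.domain :=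
  ((LinearMap.range A.toFun).subtype.restrict fun _ hy => hy) ∘ₗ strain hA B

/-- The map `z ↦ z₂` from `dom 𝒜` to `dom A`. -/
def velocity (hA : IsStiffnessFactor A) (B : Y →ₗ.[ℂ] X) : blockDomain hA B →ₗ[ℂ] A.domain :=
  (WithLp.sndL 2 ℂ (EnergySpace hA) X).toLinearMap.restrict fun _ hz => hz.2

/-- The boundary map `Γ₀ z = (Λ₁ z₂, Π₂ A z₁)`. -/
def Gamma₀ (hA : IsStiffnessFactor A) (B : Y →ₗ.[ℂ] X)
    (Lam : A.domain →ₗ[ℂ] G₁ × AntiDual G₂) (Pi : B.domain →ₗ[ℂ] AntiDual G₁ × G₂) :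
    blockDomain hA B →ₗ[ℂ] WithLp 2 (G₁ × G₂) :=
  (WithLp.linearEquiv 2 ℂ (G₁ × G₂)).symm.toLinearMap ∘ₗ
    (LinearMap.fst ℂ _ _ ∘ₗ Lam ∘ₗ velocity hA B).prod
      (LinearMap.snd ℂ _ _ ∘ₗ Pi ∘ₗ strainB hA B)

/-- The boundary map `Γ₁ z = (-Π₁ A z₁, Λ₂ z₂)`. -/
def Gamma₁ (hA : IsStiffnessFactor A) (B : Y →ₗ.[ℂ] X)
    (Lam : A.domain →ₗ[ℂ] G₁ × AntiDual G₂) (Pi : B.domain →ₗ[ℂ] AntiDual G₁ × G₂) :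
    blockDomain hA B →ₗ[ℂ] AntiDual (WithLp 2 (G₁ × G₂)) :=
  antiDualProd G₁ G₂ ∘ₗ
    (-(LinearMap.fst ℂ _ _ ∘ₗ Pi ∘ₗ strainB hA B)).prod
      (LinearMap.snd ℂ _ _ ∘ₗ Lam ∘ₗ velocity hA B)

/-- The state space `X_h × X_M` with its product Hilbert space structure. -/
abbrev StateSpace (hA : IsStiffnessFactor A) (hM : IsMassOperator M) : Type _ :=
  WithLp 2 (EnergySpace hA × WeightedSpace hM)

/-- The map `diag(I, M⁻¹)` from `X_h × X_M` to `X_h × X`. -/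
def massScaling (hA : IsStiffnessFactor A) (hM : IsMassOperator M) :
    StateSpace hA hM →ₗ[ℂ] WithLp 2 (EnergySpace hA × X) :=
  (WithLp.linearEquiv 2 ℂ (EnergySpace hA × X)).symm.toLinearMap ∘ₗ
    (LinearMap.id.prodMap (hM.inv.toLinearMap ∘ₗ (WeightedSpace.toX hM).toLinearMap)) ∘ₗ
      (WithLp.linearEquiv 2 ℂ (EnergySpace hA × WeightedSpace hM)).toLinearMap

/-- The domain of `𝒜_M`: all `(z₁, z₂) ∈ X_h × M X_h` with `A z₁ ∈ dom B_{Y₁}`. -/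
def massDomain (hA : IsStiffnessFactor A) (B : Y →ₗ.[ℂ] X) (hM : IsMassOperator M) :
    Submodule ℂ (StateSpace hA hM) :=
  ((restrictRange A B).domain.comap (A.toFun.rangeRestrict ∘ₗ
      (EnergySpace.toDomain hA).toLinearMap ∘ₗ
        (WithLp.fstL 2 ℂ (EnergySpace hA) (WeightedSpace hM)).toLinearMap)) ⊓
    (A.domain.map M.toLinearMap).comap ((WeightedSpace.toX hM).toLinearMap ∘ₗ
      (WithLp.sndL 2 ℂ (EnergySpace hA) (WeightedSpace hM)).toLinearMap)

theorem massScaling_mem (hA : IsStiffnessFactor A) (B : Y →ₗ.[ℂ] X) (hM : IsMassOperator M)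
    (z : StateSpace hA hM) (hz : z ∈ massDomain hA B hM) :
    massScaling hA hM z ∈ blockDomain hA B := by
  refine ⟨hz.1, ?_⟩
  obtain ⟨x, hx, hxz⟩ := hz.2
  change hM.inv (WeightedSpace.toX hM z.snd) ∈ A.domain
  have h : M x = WeightedSpace.toX hM z.snd := hxz
  rw [← h, hM.inv_apply]
  exact hx

/-- `diag(I, M⁻¹)` as a map from `dom 𝒜_M` to `dom 𝒜`. -/
def massScalingDom (hA : IsStiffnessFactor A) (B : Y →ₗ.[ℂ] X) (hM : IsMassOperator M) :
    massDomain hA B hM →ₗ[ℂ] blockDomain hA B :=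
  (massScaling hA hM).restrict (massScaling_mem hA B hM)

/-- The operator `𝒜_M (z₁, z₂) = (M⁻¹ z₂, B_{Y₁} A z₁ - D M⁻¹ z₂)` on `dom 𝒜_M`. -/
def massOperator (hA : IsStiffnessFactor A) (B : Y →ₗ.[ℂ] X) (hM : IsMassOperator M)
    (D : X →L[ℂ] X) : massDomain hA B hM →ₗ[ℂ] StateSpace hA hM :=
  (WithLp.linearEquiv 2 ℂ (EnergySpace hA × WeightedSpace hM)).symm.toLinearMap ∘ₗ
    (((EnergySpace.toDomain hA).symm.toLinearMap ∘ₗ velocity hA B).prod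
      ((WeightedSpace.toX hM).symm.toLinearMap ∘ₗ
        ((restrictRange A B).toFun ∘ₗ strain hA B -
          D.toLinearMap ∘ₗ A.domain.subtype ∘ₗ velocity hA B))) ∘ₗ
      massScalingDom hA B hM

/-- The colligation with input `½ ((1 - P) R Γ₀ + (1 + P) Γ₁) diag(I, M⁻¹)`, interior operator
`𝒜_M` and output `½ ((1 + P) R Γ₀ + (1 - P) Γ₁) diag(I, M⁻¹)`. -/
def secondOrderColligation (hA : IsStiffnessFactor A) (B : Y →ₗ.[ℂ] X) (hM : IsMassOperator M)
    (D : X →L[ℂ] X) (Lam : A.domain →ₗ[ℂ] G₁ × AntiDual G₂)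
    (Pi : B.domain →ₗ[ℂ] AntiDual G₁ × G₂)
    (P : AntiDual (WithLp 2 (G₁ × G₂)) →L[ℂ] AntiDual (WithLp 2 (G₁ × G₂))) :
    Colligation (AntiDual (WithLp 2 (G₁ × G₂))) (StateSpace hA hM)
      (AntiDual (WithLp 2 (G₁ × G₂))) where
  dom := massDomain hA B hM
  G := (1 / 2 : ℂ) •
    ((1 - P).toLinearMap ∘ₗ (riesz (WithLp 2 (G₁ × G₂))).toLinearEquiv.toLinearMap ∘ₗ
        Gamma₀ hA B Lam Pi +
      (1 + P).toLinearMap ∘ₗ Gamma₁ hA B Lam Pi) ∘ₗ massScalingDom hA B hM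
  L := massOperator hA B hM D
  K := (1 / 2 : ℂ) •
    ((1 + P).toLinearMap ∘ₗ (riesz (WithLp 2 (G₁ × G₂))).toLinearEquiv.toLinearMap ∘ₗ
        Gamma₀ hA B Lam Pi +
      (1 - P).toLinearMap ∘ₗ Gamma₁ hA B Lam Pi) ∘ₗ massScalingDom hA B hM

end SecondOrder

end PHNode

end

open PHNode
open scoped LinearPMap

noncomputable section

namespace PHNode

/-! Write `e = RΓ₀ + Γ₁` and `f = RΓ₀ - Γ₁`, composed with `diag(I, M⁻¹)`, for the incoming and
outgoing waves, and `L` for `𝒜_M`. The input of the colligation is `½(e - P f)` and its output `½(e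
+ P f)`; the external Cayley transform with `β = 1` therefore has input `e/√2` and output `-P f/√2`.
Green's identity and `Re⟨Dv, v⟩ ≥ 0` give `Re⟨Lz, z⟩ ≤ Re⟨Γ₁z, RΓ₀z⟩`, which by polarization is `4
Re⟨Lz, z⟩ + ‖f z‖² ≤ ‖e z‖²`. As `‖P‖ ≤ 1`, this balance yields both the scattering inequality for
the Cayley transform and dissipativity of `L` on `ker (e - P f)`.

What remains is solvability of `z - L z = w`, `e z = u` (`isWaveSystem_massOperator`). The case `u =
0` is a coercive variational problem on the energy space (`exists_weak_solution`,
`exists_massOperator_solution`); general `u` is reached by a lift with `Γ₀ = 0`, `Γ₁ = u`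
(`exists_massGamma_eq`). To replace `e` by `e - P f`, note that the transfer map from `e` to `f` at
the point 1 is a strict contraction (`exists_transfer`), so `1 - PΘ` is invertible
(`surjective_feedback`).

The main operator is thus maximally dissipative, and the Lumer-Phillips theorem, proved here by
Yosida approximation, supplies the semigroup and the resolvent. The node is closed because `L` is
closed and both waves are bounded in its graph norm. The abstract result
`IsWaveSystem.isInternallyWellPosed` serves the colligation and its Cayley transform alike. -/

theorem hasDerivWithinAt_norm_sq {Z : Type*} [NormedAddCommGroup Z] [InnerProductSpace ℂ Z]
    {f : ℝ → Z} {f' : Z} {s : Set ℝ} {t : ℝ}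
    (h : HasDerivWithinAt f f' s t) :
    HasDerivWithinAt (fun r => ‖f r‖ ^ 2) (2 * (⟪f t, f'⟫_ℂ).re) s t := by
  have h1 := (Complex.reCLM.hasFDerivAt (x := ⟪f t, f t⟫_ℂ)).comp_hasDerivWithinAt t
    (h.inner ℂ h)
  have h2 : ∀ r, ‖f r‖ ^ 2 = Complex.reCLM ⟪f r, f r⟫_ℂ :=
    fun r => norm_sq_eq_re_inner (𝕜 := ℂ) (f r)
  have h3 : Complex.reCLM (⟪f t, f'⟫_ℂ + ⟪f', f t⟫_ℂ) = 2 * (⟪f t, f'⟫_ℂ).re := by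
    rw [← inner_conj_symm f', map_add, Complex.reCLM_apply, Complex.reCLM_apply, Complex.conj_re]
    ring
  rw [← h3]
  simp_rw [h2]
  exact h1

section HilleYosida

variable {Z : Type*} [NormedAddCommGroup Z] [InnerProductSpace ℂ Z] [CompleteSpace Z]

/-! ### Exponentials of bounded dissipative operators -/

/-- The uniformly continuous group generated by a bounded operator, at real times. -/
def expFlow (Y : Z →L[ℂ] Z) (t : ℝ) : Z →L[ℂ] Z := NormedSpace.exp ((t : ℂ) • Y)

theorem hasDerivAt_expFlow (Y : Z →L[ℂ] Z) (t : ℝ) :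
    HasDerivAt (expFlow Y) (expFlow Y t * Y) t := by
  have h := (hasDerivAt_exp_smul_const (𝕂 := ℂ) Y (t : ℂ)).scomp t Complex.ofRealCLM.hasDerivAt
  rw [Complex.ofRealCLM_apply, Complex.ofReal_one, one_smul] at h
  exact h

theorem hasDerivAt_expFlow' (Y : Z →L[ℂ] Z) (t : ℝ) :
    HasDerivAt (expFlow Y) (Y * expFlow Y t) t := by
  have h := (hasDerivAt_exp_smul_const' (𝕂 := ℂ) Y (t : ℂ)).scomp t Complex.ofRealCLM.hasDerivAt
  rw [Complex.ofRealCLM_apply, Complex.ofReal_one, one_smul] at h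
  exact h

theorem hasDerivAt_expFlow_apply (Y : Z →L[ℂ] Z) (x : Z) (t : ℝ) :
    HasDerivAt (fun s => expFlow Y s x) (expFlow Y t (Y x)) t := by
  have h := ((ContinuousLinearMap.apply ℂ Z x).restrictScalars ℝ).hasFDerivAt.comp_hasDerivAt t
    (hasDerivAt_expFlow Y t)
  exact h

theorem hasDerivAt_expFlow_apply' (Y : Z →L[ℂ] Z) (x : Z) (t : ℝ) :
    HasDerivAt (fun s => expFlow Y s x) (Y (expFlow Y t x)) t := by
  have h := ((ContinuousLinearMap.apply ℂ Z x).restrictScalars ℝ).hasFDerivAt.comp_hasDerivAt t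
    (hasDerivAt_expFlow' Y t)
  exact h

@[simp] theorem expFlow_zero (Y : Z →L[ℂ] Z) : expFlow Y 0 = 1 := by
  simp [expFlow, NormedSpace.exp_zero]

theorem expFlow_add (Y : Z →L[ℂ] Z) (s t : ℝ) :
    expFlow Y (s + t) = expFlow Y s * expFlow Y t := by
  let := NormedAlgebra.restrictScalars ℚ ℂ (Z →L[ℂ] Z)
  rw [expFlow, Complex.ofReal_add, add_smul]
  exact NormedSpace.exp_add_of_commute (((Commute.refl Y).smul_left _).smul_right _)

/-- `Y - W` need not be dissipative, so its exponential has no useful bound. The right side, for `0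
≤ s ≤ t`, is a product of two contractions when `Y` and `W` are dissipative. -/
theorem expFlow_combination {Y W : Z →L[ℂ] Z} (h : Commute Y W) (s t : ℝ) :
    expFlow W t * expFlow (Y - W) s = expFlow Y s * expFlow W (t - s) := by
  let := NormedAlgebra.restrictScalars ℚ ℂ (Z →L[ℂ] Z)
  have h1 : Commute W (Y - W) := h.symm.sub_right (Commute.refl W)
  rw [expFlow, expFlow, expFlow, expFlow,
    ← NormedSpace.exp_add_of_commute ((h1.smul_left _).smul_right _),
    ← NormedSpace.exp_add_of_commute ((h.smul_left _).smul_right _)]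
  congr 1
  push_cast
  module

theorem norm_expFlow_apply_le {Y : Z →L[ℂ] Z} (hY : IsDissipative Y) {t : ℝ} (ht : 0 ≤ t)
    (x : Z) : ‖expFlow Y t x‖ ≤ ‖x‖ := by
  have hd : ∀ s : ℝ, HasDerivAt (fun r => ‖expFlow Y r x‖ ^ 2)
      (2 * (⟪expFlow Y s x, Y (expFlow Y s x)⟫_ℂ).re) s := fun s => by
    rw [← hasDerivWithinAt_univ]
    exact hasDerivWithinAt_norm_sq (hasDerivAt_expFlow_apply' Y x s).hasDerivWithinAt
  have ha : Antitone fun r => ‖expFlow Y r x‖ ^ 2 :=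
    antitone_of_hasDerivAt_nonpos hd fun s => by
      have := hY (expFlow Y s x)
      simp only [Pi.zero_apply]
      linarith
  have h := ha ht
  simp only [expFlow_zero, one_apply_eq_self] at h
  exact le_of_sq_le_sq h (norm_nonneg _)

/-- The path `s ↦ exp(tW) exp(s(Y - W)) x` runs from `exp(tW) x` to `exp(tY) x` on `[0, t]`. By
`expFlow_combination` its velocity is a contraction applied to `Y x - W x`, and the mean value
inequality applies. -/
theorem norm_expFlow_sub_le {Y W : Z →L[ℂ] Z} (hY : IsDissipative Y) (hW : IsDissipative W)
    (h : Commute Y W) {t : ℝ} (ht : 0 ≤ t) (x : Z) :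
    ‖expFlow Y t x - expFlow W t x‖ ≤ t * ‖Y x - W x‖ := by
  have hd : ∀ s ∈ Icc 0 t, HasDerivWithinAt (fun r => expFlow W t (expFlow (Y - W) r x))
      (expFlow W t (expFlow (Y - W) s ((Y - W) x))) (Icc 0 t) s := fun s _ =>
    (((expFlow W t).restrictScalars ℝ).hasFDerivAt.comp_hasDerivAt s
      (hasDerivAt_expFlow_apply (Y - W) x s)).hasDerivWithinAt
  have hb : ∀ s ∈ Ico 0 t, ‖expFlow W t (expFlow (Y - W) s ((Y - W) x))‖ ≤ ‖Y x - W x‖ := by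
    intro s hs
    have h1 := DFunLike.congr_fun (expFlow_combination h s t) ((Y - W) x)
    simp only [mul_apply_eq_comp] at h1
    rw [h1]
    exact (norm_expFlow_apply_le hY hs.1 _).trans
      (norm_expFlow_apply_le hW (sub_nonneg.mpr hs.2.le) _)
  have := norm_image_sub_le_of_norm_deriv_le_segment' hd hb t (right_mem_Icc.mpr ht)
  have h2 := DFunLike.congr_fun (expFlow_combination h t t) x
  simp only [mul_apply_eq_comp, sub_self, expFlow_zero,
    one_apply_eq_self] at h2
  simp only [h2, expFlow_zero, one_apply_eq_self, sub_zero] at this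
  linarith

theorem norm_expFlow_sub_sub_le (Y : Z →L[ℂ] Z) (x y : Z) {t C : ℝ} (ht : 0 ≤ t)
    (hC : ∀ s ∈ Icc 0 t, ‖expFlow Y s (Y x) - y‖ ≤ C) :
    ‖expFlow Y t x - x - t • y‖ ≤ C * t := by
  have hd : ∀ s ∈ Icc 0 t, HasDerivWithinAt (fun r : ℝ => expFlow Y r x - r • y)
      (expFlow Y s (Y x) - y) (Icc 0 t) s := fun s _ => by
    have h := (hasDerivAt_expFlow_apply Y x s).sub ((hasDerivAt_id s).smul_const y)
    rw [one_smul] at h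
    exact h.hasDerivWithinAt
  have := norm_image_sub_le_of_norm_deriv_le_segment' hd (fun s hs => hC s ⟨hs.1, hs.2.le⟩) t
    (right_mem_Icc.mpr ht)
  simp only [expFlow_zero, one_apply_eq_self, zero_smul, sub_zero] at this
  rwa [sub_right_comm]

/-! ### Limits of commuting dissipative approximations -/

/-- Commuting bounded dissipative operators converging strongly on a dense domain generate a
contraction semigroup in the limit. -/
theorem exists_contraction_semigroup (Y : ℕ → Z →L[ℂ] Z) (hY : ∀ n, IsDissipative (Y n))
    (hcomm : ∀ n m, Commute (Y n) (Y m)) (A : Z →ₗ.[ℂ] Z) (hA : Dense (A.domain : Set Z))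
    (hlim : ∀ x : A.domain, Tendsto (fun n => Y n x) atTop (𝓝 (A x))) :
    ∃ T : NNReal → Z →L[ℂ] Z, IsC0Semigroup T ∧ (∀ t x, ‖T t x‖ ≤ ‖x‖) ∧
      ∀ x : A.domain,
        Tendsto (fun t : NNReal => ((t : ℝ)⁻¹ : ℂ) • (T t x - x)) (𝓝[>] 0) (𝓝 (A x)) := by
  have hcauchy : ∀ (b : ℝ), 0 ≤ b → ∀ x : Z, ∀ ε > 0, ∃ N, ∀ n ≥ N, ∀ m ≥ N, ∀ t ∈ Icc 0 b,
      ‖expFlow (Y n) t x - expFlow (Y m) t x‖ ≤ ε := by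
    intro b hb x ε hε
    obtain ⟨x', hx', hxx'⟩ := Metric.dense_iff.mp hA x (ε / 3) (by positivity)
    rw [Metric.mem_ball, dist_eq_norm] at hx'
    have hc := (hlim ⟨x', hxx'⟩).cauchySeq
    rw [Metric.cauchySeq_iff] at hc
    -- `b + 1` rather than `b` keeps the quotient meaningful for `b = 0`. The other two thirds of
    -- `ε` pay for replacing `x` by `x'` in each flow.
    obtain ⟨N, hN⟩ := hc (ε / 3 / (b + 1)) (by positivity)
    refine ⟨N, fun n hn m hm t ht => ?_⟩
    have h1 := norm_expFlow_sub_le (hY n) (hY m) (hcomm n m) ht.1 x'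
    have h2 := (hN n hn m hm).le
    rw [dist_eq_norm, le_div_iff₀ (by positivity)] at h2
    have h3 := norm_expFlow_apply_le (hY n) ht.1 (x' - x)
    have h4 := norm_expFlow_apply_le (hY m) ht.1 (x' - x)
    have h5 : t * ‖Y n x' - Y m x'‖ ≤ ε / 3 := by
      refine le_trans ?_ h2
      rw [mul_comm]
      gcongr
      linarith [ht.2]
    have h6 : expFlow (Y n) t x - expFlow (Y m) t x =
        (expFlow (Y n) t x' - expFlow (Y m) t x') - expFlow (Y n) t (x' - x)
          + expFlow (Y m) t (x' - x) := by
      simp only [map_sub]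
      abel
    rw [h6]
    refine (norm_add_le _ _).trans ?_
    have h7 := norm_sub_le (expFlow (Y n) t x' - expFlow (Y m) t x') (expFlow (Y n) t (x' - x))
    linarith
  have hconv : ∀ (t : NNReal) (x : Z), ∃ y, Tendsto (fun n => expFlow (Y n) t x) atTop (𝓝 y) := by
    intro t x
    apply cauchySeq_tendsto_of_complete
    rw [Metric.cauchySeq_iff]
    intro ε hε
    obtain ⟨N, hN⟩ := hcauchy t t.2 x (ε / 2) (by positivity)
    refine ⟨N, fun n hn m hm => ?_⟩
    rw [dist_eq_norm]
    exact (hN n hn m hm t ⟨t.2, le_rfl⟩).trans_lt (by linarith)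
  choose F hF using hconv
  let T : NNReal → Z →L[ℂ] Z := fun t =>
    continuousLinearMapOfTendsto (fun n => expFlow (Y n) t) (tendsto_pi_nhds.mpr (hF t))
  have hT : ∀ (t : NNReal) (x : Z), Tendsto (fun n => expFlow (Y n) t x) atTop (𝓝 (T t x)) := hF
  have hTle : ∀ (t : NNReal) (x : Z), ‖T t x‖ ≤ ‖x‖ := fun t x =>
    le_of_tendsto (hT t x).norm (Eventually.of_forall fun n => norm_expFlow_apply_le (hY n) t.2 x)
  have hunif : ∀ (b : NNReal) (x : Z), ∀ ε > 0, ∃ N, ∀ n ≥ N, ∀ t : NNReal, t ≤ b →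
      ‖expFlow (Y n) t x - T t x‖ ≤ ε := by
    intro b x ε hε
    obtain ⟨N, hN⟩ := hcauchy b b.2 x ε hε
    exact ⟨N, fun n hn t ht => le_of_tendsto (tendsto_const_nhds.sub (hT t x)).norm
      (eventually_atTop.mpr ⟨N, fun m hm => hN n hn m hm t ⟨t.2, ht⟩⟩)⟩
  have hcont : ∀ x, Continuous fun t => T t x := by
    intro x
    have h : TendstoLocallyUniformly (fun n (t : NNReal) => expFlow (Y n) t x) (fun t => T t x)
        atTop := by
      rw [Metric.tendstoLocallyUniformly_iff]
      intro ε hε t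
      refine ⟨Iic (t + 1), Iic_mem_nhds (by simp), ?_⟩
      obtain ⟨N, hN⟩ := hunif (t + 1) x (ε / 2) (by positivity)
      filter_upwards [eventually_ge_atTop N] with n hn s hs
      rw [dist_comm, dist_eq_norm]
      exact (hN n hn s hs).trans_lt (by linarith)
    refine h.continuous (Frequently.of_forall fun n => ?_)
    have hc : Continuous fun s : ℝ => expFlow (Y n) s x :=
      continuous_iff_continuousAt.mpr fun s => (hasDerivAt_expFlow_apply (Y n) x s).continuousAt
    exact hc.comp NNReal.continuous_coe
  have hzero : T 0 = 1 := by
    ext x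
    refine tendsto_nhds_unique (hT 0 x) ?_
    simp
  refine ⟨T, ⟨hzero, fun s t => ?_, hcont⟩, hTle, fun x => ?_⟩
  · ext x
    refine tendsto_nhds_unique (hT (s + t) x) ?_
    have h1 : Tendsto (fun n => expFlow (Y n) s (expFlow (Y n) t x - T t x)) atTop (𝓝 0) := by
      refine squeeze_zero_norm (fun n => norm_expFlow_apply_le (hY n) s.2 _) ?_
      simpa using ((hT t x).sub_const (T t x)).norm
    have h2 := h1.add (hT s (T t x))
    rw [zero_add] at h2
    refine h2.congr fun n => ?_
    rw [NNReal.coe_add, expFlow_add, map_sub]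
    simp
  · rw [Metric.tendsto_nhds]
    intro ε hε
    have hc : ∀ᶠ t : NNReal in 𝓝 0, ‖T t (A x) - A x‖ < ε / 4 := by
      have := (hcont (A x)).tendsto 0
      rw [hzero] at this
      filter_upwards [Metric.tendsto_nhds.mp this (ε / 4) (by positivity)] with t ht
      rwa [dist_eq_norm] at ht
    obtain ⟨δ, hδ, hδc⟩ := (mem_nhdsGE_iff_exists_Ico_subset (a := (0 : NNReal))).mp
      (mem_nhdsWithin_of_mem_nhds hc)
    have hmem : ∀ᶠ t in 𝓝[>] (0 : NNReal), t ∈ Ioo 0 δ := Ioo_mem_nhdsGT hδ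
    filter_upwards [hmem] with t ht
    have ht0 : (0 : ℝ) < t := ht.1
    -- The remainder is bounded for the approximants and then passed to the limit. Three errors of
    -- `ε / 4` occur: `Y n x` against `A x`, the flow against `T`, and `T s (A x)` against `A x`,
    -- the last controlled by the choice of `δ`. Their sum stays strictly below `ε`.
    have hmain : ‖T t x - x - (t : ℝ) • A x‖ ≤ (3 * (ε / 4)) * t := by
      obtain ⟨N, hN⟩ := hunif t (A x) (ε / 4) (by positivity)
      refine le_of_tendsto (((hT t x).sub_const _).sub_const _).norm ?_
      filter_upwards [eventually_ge_atTop N,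
        Metric.tendsto_nhds.mp (hlim x) (ε / 4) (by positivity)] with n hn hnx
      rw [dist_eq_norm] at hnx
      refine norm_expFlow_sub_sub_le (Y n) x (A x) t.2 fun s hs => ?_
      lift s to NNReal using hs.1
      have h1 := norm_expFlow_apply_le (hY n) s.2 (Y n x - A x)
      have h2 := hN n hn s hs.2
      have h3 : ‖T s (A x) - A x‖ < ε / 4 := hδc ⟨zero_le, lt_of_le_of_lt hs.2 ht.2⟩
      have h4 : expFlow (Y n) s (Y n x) - A x = expFlow (Y n) s (Y n x - A x) +
          (expFlow (Y n) s (A x) - T s (A x)) + (T s (A x) - A x) := by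
        rw [map_sub]
        abel
      rw [h4]
      refine norm_add₃_le.trans ?_
      have h5 : ‖expFlow (Y n) s (Y n x - A x)‖ ≤ ‖Y n x - A x‖ := h1
      linarith
    have h6 : ((t : ℝ)⁻¹ : ℂ) • (T t x - x) - A x =
        ((t : ℝ)⁻¹ : ℂ) • (T t x - x - (t : ℝ) • A x) := by
      have : ((t : ℝ) : ℂ) ≠ 0 := by exact_mod_cast ht0.ne'
      rw [smul_sub _ _ ((t : ℝ) • A x), ← Complex.coe_smul, smul_smul, inv_mul_cancel₀ this,
        one_smul]
    rw [dist_eq_norm, h6, norm_smul, norm_inv, Complex.norm_of_nonneg ht0.le,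
      inv_mul_lt_iff₀ ht0]
    nlinarith

end HilleYosida

section MaximalDissipative

variable {Z : Type*} [NormedAddCommGroup Z] [InnerProductSpace ℂ Z]

/-! ### Maximally dissipative operators -/

/-- Maximally dissipative operators on a Hilbert space. -/
structure IsMaximalDissipative (A : Z →ₗ.[ℂ] Z) : Prop where
  dissipative : ∀ x : A.domain, (⟪(x : Z), A x⟫_ℂ).re ≤ 0
  surjective : ∀ w : Z, ∃ x : A.domain, (x : Z) - A x = w

/-- `R` is the resolvent of `A` at the real point `r`. -/
structure IsResolvent (A : Z →ₗ.[ℂ] Z) (r : ℝ) (R : Z →L[ℂ] Z) : Prop where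
  mem : ∀ x, R x ∈ A.domain
  right_inv : ∀ x (h : R x ∈ A.domain), (r : ℂ) • R x - A ⟨R x, h⟩ = x
  left_inv : ∀ x : A.domain, R ((r : ℂ) • (x : Z) - A x) = x

/-- A vector orthogonal to the domain has the form `x - A x`; pairing it with `x` gives `‖x‖² = Re⟨A
x, x⟩ ≤ 0`, so it vanishes. -/
theorem IsMaximalDissipative.dense_domain [CompleteSpace Z] {A : Z →ₗ.[ℂ] Z}
    (hA : IsMaximalDissipative A) : Dense (A.domain : Set Z) := by
  rw [Submodule.dense_iff_topologicalClosure_eq_top, Submodule.topologicalClosure_eq_top_iff,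
    Submodule.eq_bot_iff]
  intro w hw
  obtain ⟨x, rfl⟩ := hA.surjective w
  have h1 : ⟪(x : Z), (x : Z) - A x⟫_ℂ = 0 := hw x x.2
  have h2 := hA.dissipative x
  rw [inner_sub_right, sub_eq_zero] at h1
  have h3 : ‖(x : Z)‖ ^ 2 = (⟪(x : Z), (x : Z)⟫_ℂ).re := norm_sq_eq_re_inner (𝕜 := ℂ) (x : Z)
  rw [h1] at h3
  have h4 : x = 0 := Subtype.ext (norm_eq_zero.mp
    (pow_eq_zero_iff two_ne_zero |>.mp (le_antisymm (h3.trans_le h2) (by positivity))))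
  rw [h4, A.map_zero]
  simp

theorem mul_norm_le_norm_smul_sub {A : Z →ₗ.[ℂ] Z}
    (hA : ∀ x : A.domain, (⟪(x : Z), A x⟫_ℂ).re ≤ 0) (r : ℝ) (x : A.domain) :
    r * ‖(x : Z)‖ ≤ ‖(r : ℂ) • (x : Z) - A x‖ := by
  by_cases hx : ‖(x : Z)‖ = 0
  · simp [hx]
  have hx' : 0 < ‖(x : Z)‖ := lt_of_le_of_ne (norm_nonneg _) (Ne.symm hx)
  refine le_of_mul_le_mul_left ?_ hx'
  have h1 : (⟪(x : Z), (r : ℂ) • (x : Z) - A x⟫_ℂ).re =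
      r * ‖(x : Z)‖ ^ 2 - (⟪(x : Z), A x⟫_ℂ).re := by
    rw [inner_sub_right, inner_smul_right, Complex.sub_re, Complex.re_ofReal_mul]
    congr 2
    exact (norm_sq_eq_re_inner (𝕜 := ℂ) (x : Z)).symm
  have h2 := (Complex.re_le_norm _).trans
    (norm_inner_le_norm (𝕜 := ℂ) (x : Z) ((r : ℂ) • (x : Z) - A x))
  have := hA x
  nlinarith

theorem exists_isResolvent {A : Z →ₗ.[ℂ] Z}
    (hA : ∀ x : A.domain, (⟪(x : Z), A x⟫_ℂ).re ≤ 0) {r : ℝ} (hr : 0 < r)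
    (hs : ∀ w : Z, ∃ x : A.domain, (r : ℂ) • (x : Z) - A x = w) :
    ∃ R : Z →L[ℂ] Z, IsResolvent A r R ∧ ∀ x, ‖R x‖ ≤ r⁻¹ * ‖x‖ := by
  let S : A.domain →ₗ[ℂ] Z := (r : ℂ) • A.domain.subtype - A.toFun
  have hS : ∀ x : A.domain, S x = (r : ℂ) • (x : Z) - A x := fun _ => rfl
  have hinj : Function.Injective S := by
    rw [← LinearMap.ker_eq_bot, LinearMap.ker_eq_bot']
    intro x hx
    have h := mul_norm_le_norm_smul_sub hA r x
    rw [← hS, hx, norm_zero] at h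
    have h2 : ‖(x : Z)‖ ≤ 0 := by nlinarith [norm_nonneg (x : Z)]
    exact Subtype.ext (norm_le_zero_iff.mp h2)
  let e : A.domain ≃ₗ[ℂ] Z := LinearEquiv.ofBijective S ⟨hinj, hs⟩
  have he : ∀ x : A.domain, e x = (r : ℂ) • (x : Z) - A x := fun _ => rfl
  have hb : ∀ x, ‖((e.symm x : A.domain) : Z)‖ ≤ r⁻¹ * ‖x‖ := by
    intro x
    have h := mul_norm_le_norm_smul_sub hA r (e.symm x)
    rw [← he, e.apply_symm_apply] at h
    rwa [← div_eq_inv_mul, le_div_iff₀ hr, mul_comm]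
  refine ⟨(A.domain.subtype ∘ₗ e.symm.toLinearMap).mkContinuous r⁻¹ hb, ⟨fun x => ?_, fun x h => ?_,
    fun x => ?_⟩, hb⟩
  · exact (e.symm x).2
  · exact (he (e.symm x)).symm.trans (e.apply_symm_apply x)
  · change ((e.symm ((r : ℂ) • (x : Z) - A x) : A.domain) : Z) = x
    rw [← he, e.symm_apply_apply]

/-- With `R` the resolvent at `r`, `(s - A) R = 1 - (r - s) R`. Since `‖R‖ ≤ 1/r` and `|r - s| < r`,
the Neumann series inverts the right side. -/
theorem surjective_smul_sub_of_lt_two_mul [CompleteSpace Z] {A : Z →ₗ.[ℂ] Z}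
    (hA : ∀ x : A.domain, (⟪(x : Z), A x⟫_ℂ).re ≤ 0) {r s : ℝ} (hs : 0 < s) (hsr : s < 2 * r)
    (h : ∀ w : Z, ∃ x : A.domain, (r : ℂ) • (x : Z) - A x = w) :
    ∀ w : Z, ∃ x : A.domain, (s : ℂ) • (x : Z) - A x = w := by
  have hr : 0 < r := by linarith
  obtain ⟨R, hR, hRn⟩ := exists_isResolvent hA hr h
  have hn : ‖((r - s : ℝ) : ℂ) • R‖ < 1 := by
    have h1 : ‖R‖ ≤ r⁻¹ := R.opNorm_le_bound (by positivity) hRn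
    rw [norm_smul, Complex.norm_real, Real.norm_eq_abs]
    have h2 : |r - s| < r := abs_lt.mpr ⟨by linarith, by linarith⟩
    calc |r - s| * ‖R‖ ≤ |r - s| * r⁻¹ := by gcongr
      _ < r * r⁻¹ := by gcongr
      _ = 1 := mul_inv_cancel₀ hr.ne'
  intro w
  let u := Units.oneSub (((r - s : ℝ) : ℂ) • R) hn
  have hu : (u : Z →L[ℂ] Z) ((↑u⁻¹ : Z →L[ℂ] Z) w) = w :=
    DFunLike.congr_fun u.mul_inv w
  set x := (↑u⁻¹ : Z →L[ℂ] Z) w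
  refine ⟨⟨R x, hR.mem x⟩, ?_⟩
  have h3 := hR.right_inv x (hR.mem x)
  have h4 : x - ((r - s : ℝ) : ℂ) • R x = w := hu
  change (s : ℂ) • R x - A ⟨R x, hR.mem x⟩ = w
  rw [← h4]
  refine Eq.trans ?_ (congrArg (· - ((r - s : ℝ) : ℂ) • R x) h3)
  push_cast
  module

/-- Any ratio strictly between 1 and 2 would do: below 2 each step is allowed by the previous lemma,
above 1 the points tend to infinity, as the Yosida approximation requires. -/
theorem IsMaximalDissipative.surjective_pow [CompleteSpace Z] {A : Z →ₗ.[ℂ] Z}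
    (hA : IsMaximalDissipative A) (n : ℕ) :
    ∀ w : Z, ∃ x : A.domain, (((3 / 2 : ℝ) ^ n : ℝ) : ℂ) • (x : Z) - A x = w := by
  induction n with
  | zero => simpa using hA.surjective
  | succ n ih =>
    refine surjective_smul_sub_of_lt_two_mul hA.dissipative (by positivity) ?_ ih
    have : 0 < (3 / 2 : ℝ) ^ n := by positivity
    rw [pow_succ]
    linarith

/-! ### Resolvent identity, Yosida approximation and the Lumer-Phillips theorem. -/

theorem IsResolvent.sub_eq {A : Z →ₗ.[ℂ] Z} {r s : ℝ} {R S : Z →L[ℂ] Z}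
    (hR : IsResolvent A r R) (hS : IsResolvent A s S) : R - S = ((s - r : ℝ) : ℂ) • (R * S) := by
  ext x
  have h1 := hS.right_inv x (hS.mem x)
  have h2 : R ((r : ℂ) • S x - A ⟨S x, hS.mem x⟩) = S x := hR.left_inv ⟨S x, hS.mem x⟩
  change R x - S x = ((s - r : ℝ) : ℂ) • R (S x)
  have h3 : R x = ((s - r : ℝ) : ℂ) • R (S x) + S x := by
    have h4 := congrArg R h1
    rw [map_sub, map_smul] at h2 h4
    rw [← h4]
    refine Eq.trans ?_ (congrArg (((s - r : ℝ) : ℂ) • R (S x) + ·) h2)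
    push_cast
    module
  rw [h3, add_sub_cancel_right]

/-- The resolvent identity written in both orders gives the claim after division by `s - r`; at `s =
r` it says that the resolvents coincide. -/
theorem IsResolvent.commute {A : Z →ₗ.[ℂ] Z} {r s : ℝ} {R S : Z →L[ℂ] Z}
    (hR : IsResolvent A r R) (hS : IsResolvent A s S) : Commute R S := by
  have h1 := hR.sub_eq hS
  have h2 := hS.sub_eq hR
  by_cases hrs : r = s
  · rw [hrs, sub_self, Complex.ofReal_zero, zero_smul, sub_eq_zero] at h1
    rw [h1]
  · have h3 : ((s - r : ℝ) : ℂ) ≠ 0 := by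
      rw [Complex.ofReal_ne_zero]
      exact sub_ne_zero.mpr (Ne.symm hrs)
    refine smul_right_injective _ h3 ?_
    change ((s - r : ℝ) : ℂ) • (R * S) = ((s - r : ℝ) : ℂ) • (S * R)
    rw [← h1, ← neg_sub S R, h2, ← neg_smul]
    congr 1
    push_cast
    ring

/-- The Yosida approximation `r² R - r` attached to the resolvent `R` at `r`. -/
def yosida (r : ℝ) (R : Z →L[ℂ] Z) : Z →L[ℂ] Z := ((r ^ 2 : ℝ) : ℂ) • R - (r : ℂ) • 1

theorem isDissipative_yosida {r : ℝ} (hr : 0 < r) {R : Z →L[ℂ] Z}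
    (hR : ∀ x, ‖R x‖ ≤ r⁻¹ * ‖x‖) : IsDissipative (yosida r R) := by
  intro x
  have h1 : (⟪x, yosida r R x⟫_ℂ).re = r ^ 2 * (⟪x, R x⟫_ℂ).re - r * ‖x‖ ^ 2 := by
    change (⟪x, ((r ^ 2 : ℝ) : ℂ) • R x - (r : ℂ) • x⟫_ℂ).re = _
    rw [inner_sub_right, inner_smul_right, inner_smul_right, Complex.sub_re,
      Complex.re_ofReal_mul, Complex.re_ofReal_mul]
    congr 2
    exact (norm_sq_eq_re_inner (𝕜 := ℂ) x).symm
  have h2 := (Complex.re_le_norm _).trans (norm_inner_le_norm (𝕜 := ℂ) x (R x))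
  rw [h1, sub_nonpos]
  calc r ^ 2 * (⟪x, R x⟫_ℂ).re ≤ r ^ 2 * (‖x‖ * (r⁻¹ * ‖x‖)) := by
        gcongr
        exact h2.trans (by gcongr; exact hR x)
    _ = r * ‖x‖ ^ 2 := by field_simp

/-- This form reduces the convergence of the Yosida approximations to that of `r R` to the identity.
-/
theorem IsResolvent.yosida_apply {A : Z →ₗ.[ℂ] Z} {r : ℝ} {R : Z →L[ℂ] Z}
    (hR : IsResolvent A r R) (x : A.domain) : yosida r R x = (r : ℂ) • R (A x) := by
  have h := hR.left_inv x
  rw [map_sub, map_smul] at h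
  change ((r ^ 2 : ℝ) : ℂ) • R x - (r : ℂ) • (x : Z) = _
  nth_rw 2 [← h]
  push_cast
  module

/-- On the domain `r R x - x = R (A x)`, which is of order `1/r`; the bound `‖r R‖ ≤ 1` extends the
convergence by density. -/
theorem tendsto_smul_resolvent {A : Z →ₗ.[ℂ] Z} (hd : Dense (A.domain : Set Z)) {r : ℕ → ℝ}
    (hr : ∀ n, 0 < r n) (hlim : Tendsto r atTop atTop) {R : ℕ → Z →L[ℂ] Z}
    (hR : ∀ n, IsResolvent A (r n) (R n)) (hRn : ∀ n x, ‖R n x‖ ≤ (r n)⁻¹ * ‖x‖) (y : Z) :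
    Tendsto (fun n => (r n : ℂ) • R n y) atTop (𝓝 y) := by
  rw [Metric.tendsto_nhds]
  intro ε hε
  obtain ⟨x, hx, hxd⟩ := Metric.dense_iff.mp hd y (ε / 3) (by positivity)
  rw [Metric.mem_ball, dist_eq_norm] at hx
  have h0 : Tendsto (fun n => (r n)⁻¹ * ‖A ⟨x, hxd⟩‖) atTop (𝓝 0) := by
    simpa using hlim.inv_tendsto_atTop.mul_const ‖A ⟨x, hxd⟩‖
  filter_upwards [(tendsto_order.mp h0).2 (ε / 3) (by positivity)] with n hn
  have h1 := (hR n).left_inv ⟨x, hxd⟩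
  rw [map_sub, map_smul] at h1
  have h2 : (r n : ℂ) • R n y - y =
      -((r n : ℂ) • R n (x - y)) + R n (A ⟨x, hxd⟩) + (x - y) := by
    have h3 : (r n : ℂ) • R n x = x + R n (A ⟨x, hxd⟩) := sub_eq_iff_eq_add.mp h1
    rw [map_sub, smul_sub, h3]
    abel
  rw [dist_eq_norm, h2]
  refine norm_add₃_le.trans_lt ?_
  have h4 : ‖-((r n : ℂ) • R n (x - y))‖ ≤ ‖x - y‖ := by
    rw [norm_neg, norm_smul, Complex.norm_of_nonneg (hr n).le]
    calc r n * ‖R n (x - y)‖ ≤ r n * ((r n)⁻¹ * ‖x - y‖) := by gcongr; exacts [(hr n).le, hRn n _]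
      _ = ‖x - y‖ := by rw [← mul_assoc, mul_inv_cancel₀ (hr n).ne', one_mul]
  have h5 := hRn n (A ⟨x, hxd⟩)
  linarith

/-- The Lumer-Phillips theorem. -/
theorem IsMaximalDissipative.generatesC0Semigroup [CompleteSpace Z] {A : Z →ₗ.[ℂ] Z}
    (hA : IsMaximalDissipative A) : GeneratesC0Semigroup A := by
  let r : ℕ → ℝ := fun n => (3 / 2 : ℝ) ^ n
  have hr : ∀ n, 0 < r n := fun n => by positivity
  have hrlim : Tendsto r atTop atTop := tendsto_pow_atTop_atTop_of_one_lt (by norm_num)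
  choose R hR hRn using fun n => exists_isResolvent hA.dissipative (hr n) (hA.surjective_pow n)
  obtain ⟨T, hT, hTle, hgen⟩ := exists_contraction_semigroup (fun n => yosida (r n) (R n))
    (fun n => isDissipative_yosida (hr n) (hRn n))
    (fun n m => by
      have h := (hR n).commute (hR m)
      have h1 : Commute (R n) (yosida (r m) (R m)) :=
        (h.smul_right _).sub_right ((Commute.one_right _).smul_right _)
      exact (h1.smul_left _).sub_left ((Commute.one_left _).smul_left _))
    A hA.dense_domain
    (fun x => by
      simp_rw [(hR _).yosida_apply x]
      exact tendsto_smul_resolvent hA.dense_domain hr hrlim hR hRn (A x))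
  refine ⟨T, hT, fun x y => ⟨fun h => ?_, fun h => ?_⟩⟩
  · obtain ⟨u, hu1, hu2⟩ := A.mem_graph_iff.mp h
    have := hgen u
    rw [hu1, hu2] at this
    exact this
  -- The generator of `T` extends `A`; maximality shows that it is no larger. With `u - A u = x -
  -- y`, the difference quotients at `x - u` converge to `x - u` itself, while contractivity makes
  -- their pairing with `x - u` have nonpositive real part. Hence `x = u`.
  · obtain ⟨u, hu⟩ := hA.surjective (x - y)
    have h1 := h.sub (hgen u)
    have h2 : y - A u = x - u := by
      rw [sub_eq_sub_iff_add_eq_add] at hu ⊢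
      rw [add_comm y, hu]
    rw [h2] at h1
    have h3 : Tendsto (fun t : NNReal => (⟪x - u, ((t : ℝ)⁻¹ : ℂ) • (T t x - x) -
        ((t : ℝ)⁻¹ : ℂ) • (T t u - u)⟫_ℂ).re) (𝓝[>] 0) (𝓝 (⟪x - u, x - u⟫_ℂ).re) :=
      (Complex.continuous_re.tendsto _).comp (tendsto_const_nhds.inner h1)
    have h4 : (⟪x - u, x - u⟫_ℂ).re ≤ 0 := by
      refine le_of_tendsto h3 (Eventually.of_forall fun t => ?_)
      have h5 : ((t : ℝ)⁻¹ : ℂ) • (T t x - x) - ((t : ℝ)⁻¹ : ℂ) • (T t u - u) =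
          (((t : ℝ)⁻¹ : ℝ) : ℂ) • (T t (x - u) - (x - u)) := by
        rw [map_sub]
        push_cast
        module
      have h6 : (⟪x - u, T t (x - u)⟫_ℂ).re ≤ ‖(x - u : Z)‖ ^ 2 := by
        refine (Complex.re_le_norm _).trans ((norm_inner_le_norm _ _).trans ?_)
        rw [pow_two]
        gcongr
        exact hTle t _
      have h7 : (⟪x - u, x - u⟫_ℂ).re = ‖(x - u : Z)‖ ^ 2 :=
        (norm_sq_eq_re_inner (𝕜 := ℂ) (x - u : Z)).symm
      rw [h5, inner_smul_right, Complex.re_ofReal_mul, inner_sub_right, Complex.sub_re, h7]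
      exact mul_nonpos_of_nonneg_of_nonpos (by positivity) (sub_nonpos.mpr h6)
    have h8 : x - (u : Z) = 0 := by
      have h7 : ‖(x - u : Z)‖ ^ 2 = (⟪x - u, x - u⟫_ℂ).re :=
        norm_sq_eq_re_inner (𝕜 := ℂ) (x - u : Z)
      exact norm_eq_zero.mp (pow_eq_zero_iff two_ne_zero |>.mp
        (le_antisymm (h7.trans_le h4) (by positivity)))
    rw [h8, sub_eq_zero] at h2
    rw [sub_eq_zero.mp h8, h2]
    exact A.mem_graph u

theorem IsMaximalDissipative.inResolventSet_one {A : Z →ₗ.[ℂ] Z}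
    (hA : IsMaximalDissipative A) : InResolventSet A 1 := by
  obtain ⟨R, hR, -⟩ := exists_isResolvent hA.dissipative one_pos
    (by simpa using hA.surjective)
  refine ⟨R, fun x => ⟨hR.mem x, ?_⟩, fun x => ?_⟩
  · simpa using hR.right_inv x (hR.mem x)
  · simpa using hR.left_inv x

end MaximalDissipative

section EnergyBalance

variable {U Z W : Type*}
  [NormedAddCommGroup U] [InnerProductSpace ℂ U]
  [NormedAddCommGroup Z] [InnerProductSpace ℂ Z]
  [NormedAddCommGroup W] [InnerProductSpace ℂ W]

/-! ### Internally well-posed colligations from an energy balance -/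

/-- A closed operator `L` with boundary maps `e` (incoming wave) and `f` (outgoing wave) that obeys
an energy balance and for which `z - L z = w`, `e z = u` can be solved. -/
structure IsWaveSystem {dom : Submodule ℂ Z} (L : dom →ₗ[ℂ] Z) (e f : dom →ₗ[ℂ] U) : Prop where
  closed : (LinearPMap.mk dom L).IsClosed
  bounded : ∃ C : ℝ, ∀ z : dom,
    ‖e z‖ ≤ C * (‖(z : Z)‖ + ‖L z‖) ∧ ‖f z‖ ≤ C * (‖(z : Z)‖ + ‖L z‖)
  energy : ∀ z : dom, 4 * (⟪(z : Z), L z⟫_ℂ).re + ‖f z‖ ^ 2 ≤ ‖e z‖ ^ 2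
  surjective : ∀ (w : Z) (u : U), ∃ z : dom, (z : Z) - L z = w ∧ e z = u

variable {dom : Submodule ℂ Z} {L : dom →ₗ[ℂ] Z} {e f : dom →ₗ[ℂ] U}

/-- The transfer function from incoming to outgoing waves at the point `1` is a strict
contraction. -/
theorem IsWaveSystem.exists_transfer (h : IsWaveSystem L e f) :
    ∃ (s : U → dom) (Θ : U →L[ℂ] U), ‖Θ‖ < 1 ∧
      ∀ u, (s u : Z) - L (s u) = 0 ∧ e (s u) = u ∧ f (s u) = Θ u := by
  let N : Submodule ℂ dom := LinearMap.ker (dom.subtype - L)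
  have hN : ∀ z : N, L z = ((z : dom) : Z) := fun z => (sub_eq_zero.mp z.2).symm
  have henergy : ∀ z : N, 4 * ‖((z : dom) : Z)‖ ^ 2 + ‖f z‖ ^ 2 ≤ ‖e z‖ ^ 2 := by
    intro z
    have h1 := h.energy z
    rw [hN] at h1
    rw [norm_sq_eq_re_inner (𝕜 := ℂ) ((z : dom) : Z)]
    exact h1
  have hinj : Function.Injective (e ∘ₗ N.subtype) := by
    rw [← LinearMap.ker_eq_bot, LinearMap.ker_eq_bot']
    intro z hz
    have h1 := henergy z
    rw [show e z = 0 from hz, norm_zero] at h1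
    have h2 : ‖((z : dom) : Z)‖ ^ 2 = 0 :=
      le_antisymm (by nlinarith [sq_nonneg ‖f z‖]) (by positivity)
    exact Subtype.ext (Subtype.ext (norm_eq_zero.mp (pow_eq_zero_iff two_ne_zero |>.mp h2)))
  have hsurj : Function.Surjective (e ∘ₗ N.subtype) := by
    intro u
    obtain ⟨z, hz1, hz2⟩ := h.surjective 0 u
    exact ⟨⟨z, hz1⟩, hz2⟩
  let E : N ≃ₗ[ℂ] U := LinearEquiv.ofBijective (e ∘ₗ N.subtype) ⟨hinj, hsurj⟩
  have hE : ∀ u, e (E.symm u) = u := fun u => E.apply_symm_apply u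
  obtain ⟨C, hC⟩ := h.bounded
  -- On the kernel of `1 - L` the energy balance reads `4‖z‖² + ‖f z‖² ≤ ‖e z‖²`, and boundedness
  -- gives `‖e z‖ ≤ 2C'‖z‖`, so `‖f z‖² ≤ (1 - 1/C'²)‖e z‖²`. Taking `C' ≥ 1` keeps this factor
  -- nonnegative.
  let C' := max C 1
  have hC'1 : 1 ≤ C' := le_max_right _ _
  have hk0 : 0 ≤ 1 - 1 / C' ^ 2 := by
    rw [sub_nonneg, div_le_one (by positivity)]
    nlinarith
  have hk1 : Real.sqrt (1 - 1 / C' ^ 2) < 1 := by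
    rw [Real.sqrt_lt' one_pos]
    have : 0 < 1 / C' ^ 2 := by positivity
    linarith
  have hb : ∀ u, ‖f (E.symm u)‖ ≤ Real.sqrt (1 - 1 / C' ^ 2) * ‖u‖ := by
    intro u
    have h1 := henergy (E.symm u)
    have h2 := (hC (E.symm u)).1
    rw [hE] at h1 h2
    rw [hN] at h2
    set n := ‖((E.symm u : dom) : Z)‖
    have h3 : ‖u‖ ≤ 2 * C' * n := by
      refine h2.trans ?_
      have : C * n ≤ C' * n := by gcongr; exact le_max_left _ _
      linarith
    have h4 : ‖u‖ ^ 2 ≤ (2 * C' * n) ^ 2 := by gcongr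
    have h5 : 1 / C' ^ 2 * ‖u‖ ^ 2 ≤ 4 * n ^ 2 := by
      rw [div_mul_eq_mul_div, one_mul, div_le_iff₀ (by positivity)]
      linarith
    refine le_of_sq_le_sq ?_ (by positivity)
    rw [mul_pow, Real.sq_sqrt hk0]
    linarith
  refine ⟨fun u => E.symm u,
    (f ∘ₗ N.subtype ∘ₗ E.symm.toLinearMap).mkContinuous _ hb, ?_, fun u => ⟨?_, hE u, rfl⟩⟩
  · exact (LinearMap.mkContinuous_norm_le _ (Real.sqrt_nonneg _) hb).trans_lt hk1
  · rw [hN, sub_self]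

/-- Start from a solution `z` with no incoming wave and add the homogeneous solution with incoming
wave `v`. The condition on `v` is `(1 - PΘ) v = u + P (f z)`, solvable because `Θ` is a strict
contraction even if `‖P‖ = 1`. -/
theorem IsWaveSystem.surjective_feedback [CompleteSpace U] (h : IsWaveSystem L e f)
    {P : U →L[ℂ] U} (hP : ‖P‖ ≤ 1)
    (w : Z) (u : U) : ∃ z : dom, (z : Z) - L z = w ∧ e z - P (f z) = u := by
  obtain ⟨s, Θ, hΘ, hs⟩ := h.exists_transfer
  have hn : ‖P * Θ‖ < 1 := by
    calc ‖P * Θ‖ ≤ ‖P‖ * ‖Θ‖ := norm_mul_le _ _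
      _ ≤ 1 * ‖Θ‖ := by gcongr
      _ < 1 := by rwa [one_mul]
  obtain ⟨z, hz1, hz2⟩ := h.surjective w 0
  let Q := Units.oneSub (P * Θ) hn
  set v := (↑Q⁻¹ : U →L[ℂ] U) (u + P (f z))
  have hv : v - P (Θ v) = u + P (f z) := DFunLike.congr_fun Q.mul_inv (u + P (f z))
  obtain ⟨hv1, hv2, hv3⟩ := hs v
  refine ⟨z + s v, ?_, ?_⟩
  · rw [map_add, Submodule.coe_add, add_sub_add_comm, hz1, hv1, add_zero]
  · rw [map_add, map_add, map_add, hz2, hv2, hv3, zero_add, sub_add_eq_sub_sub_swap, hv,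
      add_sub_cancel_right]

variable [CompleteSpace U] [CompleteSpace Z] [CompleteSpace W]

/-- Closedness of `L` alone places the limit in the domain; convergence in its graph norm then
forces the limits of `G` and `K`. -/
theorem combined_isClosed (Θ : Colligation U Z W) (hL : (LinearPMap.mk Θ.dom Θ.L).IsClosed)
    {C : ℝ} (hG : ∀ z, ‖Θ.G z‖ ≤ C * (‖(z : Z)‖ + ‖Θ.L z‖))
    (hK : ∀ z, ‖Θ.K z‖ ≤ C * (‖(z : Z)‖ + ‖Θ.L z‖)) : Θ.combined.IsClosed := by
  refine IsSeqClosed.isClosed fun x p hx hlim => ?_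
  have hx' : ∀ n, ∃ z : Θ.dom, (z : Z) = (x n).1 ∧ (Θ.G z, Θ.L z, Θ.K z) = (x n).2 :=
    fun n => Θ.combined.mem_graph_iff.mp (hx n)
  choose z hz1 hz2 using hx'
  obtain ⟨z₀, u₀, w₀, y₀⟩ := p
  have hlim1 : Tendsto (fun n => ((z n : Θ.dom) : Z)) atTop (𝓝 z₀) := by
    simp_rw [hz1]
    exact (continuous_fst.tendsto _).comp hlim
  have hlim2 : Tendsto (fun n => (Θ.G (z n), Θ.L (z n), Θ.K (z n))) atTop (𝓝 (u₀, w₀, y₀)) := by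
    simp_rw [hz2]
    exact (continuous_snd.tendsto _).comp hlim
  have hlimG : Tendsto (fun n => Θ.G (z n)) atTop (𝓝 u₀) := (continuous_fst.tendsto _).comp hlim2
  have hlimL : Tendsto (fun n => Θ.L (z n)) atTop (𝓝 w₀) :=
    (continuous_fst.tendsto _).comp ((continuous_snd.tendsto _).comp hlim2)
  have hlimK : Tendsto (fun n => Θ.K (z n)) atTop (𝓝 y₀) :=
    (continuous_snd.tendsto _).comp ((continuous_snd.tendsto _).comp hlim2)
  have hg : (z₀, w₀) ∈ (LinearPMap.mk Θ.dom Θ.L).graph :=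
    hL.mem_of_tendsto (hlim1.prodMk_nhds hlimL)
      (Eventually.of_forall fun n => LinearPMap.mem_graph (LinearPMap.mk Θ.dom Θ.L) (z n))
  obtain ⟨q, hq1, hq2⟩ : ∃ q : Θ.dom, (q : Z) = z₀ ∧ Θ.L q = w₀ :=
    LinearPMap.mem_graph_iff _ |>.mp hg
  subst hq1 hq2
  have h0 : Tendsto (fun n => C * (‖((z n - q : Θ.dom) : Z)‖ + ‖Θ.L (z n - q)‖)) atTop (𝓝 0) := by
    have h1 := tendsto_iff_norm_sub_tendsto_zero.mp hlim1
    have h2 := tendsto_iff_norm_sub_tendsto_zero.mp hlimL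
    have h3 := (h1.add h2).const_mul C
    rw [add_zero, mul_zero] at h3
    simpa only [map_sub, Submodule.coe_sub] using h3
  have hG' : Θ.G q = u₀ := by
    refine tendsto_nhds_unique (tendsto_iff_norm_sub_tendsto_zero.mpr ?_) hlimG
    refine squeeze_zero (fun _ => norm_nonneg _) (fun n => ?_) h0
    rw [← map_sub]
    exact hG _
  have hK' : Θ.K q = y₀ := by
    refine tendsto_nhds_unique (tendsto_iff_norm_sub_tendsto_zero.mpr ?_) hlimK
    refine squeeze_zero (fun _ => norm_nonneg _) (fun n => ?_) h0
    rw [← map_sub]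
    exact hK _
  subst hG' hK'
  exact Θ.combined.mem_graph q

/-- On `ker G` one has `e z = P (f z)`, hence `‖e z‖ ≤ ‖f z‖`, and the energy balance gives
dissipativity; `surjective_feedback` gives the range condition and the surjectivity of `G`. The
output matters only for closedness, so a bound on it suffices. -/
theorem IsWaveSystem.isInternallyWellPosed (Θ : Colligation U Z W) {e f : Θ.dom →ₗ[ℂ] U}
    (h : IsWaveSystem Θ.L e f) {P : U →L[ℂ] U} (hP : ‖P‖ ≤ 1) {c : ℂ} (hc : c ≠ 0)
    (hG : ∀ z, Θ.G z = c • (e z - P (f z))) {k : ℝ} (hK : ∀ z, ‖Θ.K z‖ ≤ k * (‖e z‖ + ‖f z‖)) :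
    Θ.IsInternallyWellPosed := by
  have hPf : ∀ z, ‖P (f z)‖ ≤ ‖f z‖ := fun z =>
    (P.le_opNorm _).trans (mul_le_of_le_one_left (norm_nonneg _) hP)
  have hker : ∀ z : Θ.dom, Θ.G z = 0 ↔ e z - P (f z) = 0 := fun z => by
    rw [hG, smul_eq_zero_iff_right hc]
  have happly : ∀ (x : Θ.mainOperator.domain) (z : Θ.dom), (x : Z) = z →
      Θ.mainOperator x = Θ.L z := fun x z hxz => LinearPMap.domRestrict_apply hxz
  have hmax : IsMaximalDissipative Θ.mainOperator := by
    refine ⟨fun x => ?_, fun w => ?_⟩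
    · obtain ⟨z, hz, hzx⟩ := x.2.1
      have hzx' : (z : Z) = x := hzx
      rw [happly x z hzx.symm, ← hzx']
      have h1 := h.energy z
      have h2 : e z = P (f z) := sub_eq_zero.mp ((hker z).mp hz)
      have h3 := hPf z
      rw [h2] at h1
      have h4 : ‖P (f z)‖ ^ 2 ≤ ‖f z‖ ^ 2 := by gcongr
      linarith
    · obtain ⟨z, hz1, hz2⟩ := h.surjective_feedback hP w 0
      have hz : (z : Z) ∈ Θ.mainOperator.domain := ⟨⟨z, (hker z).mpr hz2, rfl⟩, z.2⟩
      refine ⟨⟨z, hz⟩, ?_⟩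
      rw [happly ⟨z, hz⟩ z rfl]
      exact hz1
  refine ⟨⟨?_, fun u => ?_, ?_, 1, hmax.inResolventSet_one⟩, hmax.generatesC0Semigroup⟩
  · obtain ⟨C, hC⟩ := h.bounded
    have hC0 : ∀ z : Θ.dom, ‖e z‖ + ‖f z‖ ≤ 2 * C * (‖(z : Z)‖ + ‖Θ.L z‖) := fun z => by
      have := hC z
      linarith
    have hpos : ∀ z : Θ.dom, 0 ≤ ‖e z‖ + ‖f z‖ := fun z => by positivity
    refine combined_isClosed Θ h.closed (C := max ‖c‖ |k| * (2 * C)) (fun z => ?_) (fun z => ?_)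
    · rw [hG, norm_smul, mul_assoc]
      refine mul_le_mul (le_max_left _ _) ?_ (norm_nonneg _) (by positivity)
      exact (norm_sub_le _ _).trans ((add_le_add le_rfl (hPf z)).trans (hC0 z))
    · refine (hK z).trans ?_
      rw [mul_assoc]
      exact mul_le_mul ((le_abs_self k).trans (le_max_right _ _)) (hC0 z) (hpos z) (by positivity)
  · obtain ⟨z, -, hz⟩ := h.surjective_feedback hP 0 (c⁻¹ • u)
    refine ⟨z, ?_⟩
    rw [hG, hz, smul_smul, mul_inv_cancel₀ hc, one_smul]
  · refine hmax.dense_domain.mono ?_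
    exact fun x hx => hx.1

theorem isScatteringPassive_of_energy (Θ : Colligation U Z W) (hwp : Θ.IsInternallyWellPosed)
    (h : ∀ z : Θ.dom, 2 * (⟪(z : Z), Θ.L z⟫_ℂ).re + ‖Θ.K z‖ ^ 2 ≤ ‖Θ.G z‖ ^ 2) :
    Θ.IsScatteringPassive := by
  refine ⟨hwp, fun u z y hs t ht => ?_⟩
  rw [(hasDerivWithinAt_norm_sq (hs.state_eq t ht)).derivWithin (uniqueDiffOn_Ici 0 t ht),
    hs.output_eq t ht, hs.input_eq t ht]
  exact h (z t)

end EnergyBalance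

section Nondegenerate

/-! ### Boundary triplets for dual pairs -/

variable {X Y : Type*} [NormedAddCommGroup X] [InnerProductSpace ℂ X]
  [NormedAddCommGroup Y] [InnerProductSpace ℂ Y]
  {G₁ G₂ : Type*} [NormedAddCommGroup G₁] [InnerProductSpace ℂ G₁]
  [NormedAddCommGroup G₂] [InnerProductSpace ℂ G₂]
  {A : X →ₗ.[ℂ] Y} {B : Y →ₗ.[ℂ] X}
  {Lam : A.domain →ₗ[ℂ] G₁ × AntiDual G₂} {Pi : B.domain →ₗ[ℂ] AntiDual G₁ × G₂}

namespace IsDualPairBoundaryTriplet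

/-- Surjectivity of `Pi` makes the boundary form nondegenerate, so Green's identity determines the
boundary values. The test values `(riesz G₁ g.1, 0)` and `(0, k)` isolate the two components. -/
theorem eq_zero_left [CompleteSpace G₁] (hΓ : IsDualPairBoundaryTriplet A B Lam Pi)
    {g : G₁ × AntiDual G₂}
    (h : ∀ y, (Pi y).1 g.1 - (starRingEnd ℂ) (g.2 (Pi y).2) = 0) : g = 0 := by
  refine Prod.ext ?_ (ContinuousLinearMap.ext fun k => ?_)
  · obtain ⟨y, hy⟩ := hΓ.surjective_right (riesz G₁ g.1, 0)
    have h1 := h y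
    rw [hy] at h1
    simpa using h1
  · obtain ⟨y, hy⟩ := hΓ.surjective_right (0, k)
    have h1 := h y
    rw [hy] at h1
    simpa using h1

theorem eq_zero_right [CompleteSpace G₂] (hΓ : IsDualPairBoundaryTriplet A B Lam Pi)
    {g : AntiDual G₁ × G₂}
    (h : ∀ x, g.1 (Lam x).1 - (starRingEnd ℂ) ((Lam x).2 g.2) = 0) : g = 0 := by
  refine Prod.ext (ContinuousLinearMap.ext fun k => ?_) ?_
  · obtain ⟨x, hx⟩ := hΓ.surjective_left (k, 0)
    have h1 := h x
    rw [hx] at h1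
    simpa using h1
  · obtain ⟨x, hx⟩ := hΓ.surjective_left (0, riesz G₂ g.2)
    have h1 := h x
    rw [hx] at h1
    simpa using h1

/-- Orthogonality to `ran A` means `A* y = 0`, hence `B y = 0` by `A* ⊂ -B`. The left side of
Green's identity then vanishes for every `x`. -/
theorem map_eq_zero_of_orthogonal [CompleteSpace X] [CompleteSpace G₂]
    (hΓ : IsDualPairBoundaryTriplet A B Lam Pi)
    (hA : IsStiffnessFactor A) (hAB : A† ≤ -B) {y : Y} (hy : ∀ x : A.domain, ⟪A x, y⟫_ℂ = 0) :
    ∃ h : y ∈ B.domain, Pi ⟨y, h⟩ = 0 := by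
  have hs : ∀ x : A.domain, ⟪(0 : X), (x : X)⟫_ℂ = ⟪y, A x⟫_ℂ := fun x => by
    rw [inner_zero_left, ← inner_conj_symm, hy x, map_zero]
  have hyd : y ∈ A†.domain := LinearPMap.mem_adjoint_domain_of_exists _ ⟨0, hs⟩
  have hAy : A† ⟨y, hyd⟩ = 0 := LinearPMap.adjoint_apply_eq hA.dense ⟨y, hyd⟩ hs
  have hBy : B ⟨y, hAB.1 hyd⟩ = 0 := by
    have h1 : A† ⟨y, hyd⟩ = -B ⟨y, hAB.1 hyd⟩ :=
      hAB.2 (x := ⟨y, hyd⟩) (y := ⟨y, hAB.1 hyd⟩) rfl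
    rw [hAy] at h1
    exact neg_eq_zero.mp h1.symm
  refine ⟨hAB.1 hyd, hΓ.eq_zero_right fun x => ?_⟩
  rw [← hΓ.green, hBy, hy x]
  simp

end IsDualPairBoundaryTriplet

end Nondegenerate

/-! ### Boundedness of the boundary maps and the adjoint description of `B`. -/

section DualPair

variable {X Y : Type*} [NormedAddCommGroup X] [InnerProductSpace ℂ X] [CompleteSpace X]
  [NormedAddCommGroup Y] [InnerProductSpace ℂ Y] [CompleteSpace Y]

/-- A closed subspace of a product contains every vector that annihilates its annihilator. -/
theorem mem_of_forall_inner_add_eq_zero {g : Submodule ℂ (X × Y)} (hg : IsClosed (g : Set (X × Y)))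
    {a : X} {b : Y}
    (h : ∀ p q, (∀ x y, (x, y) ∈ g → ⟪x, p⟫_ℂ + ⟪y, q⟫_ℂ = 0) → ⟪a, p⟫_ℂ + ⟪b, q⟫_ℂ = 0) :
    (a, b) ∈ g := by
  let g' : Submodule ℂ (WithLp 2 (X × Y)) :=
    g.comap (WithLp.linearEquiv 2 ℂ (X × Y)).toLinearMap
  have hg' : IsClosed (g' : Set (WithLp 2 (X × Y))) :=
    IsClosed.preimage (WithLp.prod_continuous_ofLp 2 X Y) hg
  have : CompleteSpace g' := hg'.completeSpace_coe
  have h1 : WithLp.toLp 2 (a, b) ∈ g'ᗮᗮ := by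
    rw [Submodule.mem_orthogonal']
    intro r hr
    refine h r.fst r.snd fun x y hxy => ?_
    exact (Submodule.mem_orthogonal _ _).mp hr (WithLp.toLp 2 (x, y)) hxy
  rw [Submodule.orthogonal_orthogonal] at h1
  exact h1

namespace EnergySpace

variable {A : X →ₗ.[ℂ] Y} (hA : IsStiffnessFactor A)

/-- The bounded embedding of the energy space into `X`. -/
def embed : EnergySpace hA →L[ℂ] X :=
  (A.domain.subtype ∘ₗ (toDomain hA).toLinearMap).mkContinuousOfExistsBound (by
    obtain ⟨c, hc, h⟩ := hA.lower_bound
    refine ⟨(Real.sqrt c)⁻¹, fun x => ?_⟩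
    rw [← div_eq_inv_mul, le_div_iff₀ (by positivity)]
    refine le_of_sq_le_sq ?_ (norm_nonneg _)
    rw [mul_pow, Real.sq_sqrt hc.le, mul_comm]
    exact h (toDomain hA x))

theorem embed_apply (x : EnergySpace hA) : embed hA x = (toDomain hA x : X) := rfl

/-- `A` as an isometry on the energy space. -/
def mapIsometry : EnergySpace hA →ₗᵢ[ℂ] Y := ⟨map hA, fun _ => rfl⟩

end EnergySpace

variable {G₁ G₂ : Type*} [NormedAddCommGroup G₁] [InnerProductSpace ℂ G₁]
  [NormedAddCommGroup G₂] [InnerProductSpace ℂ G₂]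
  {A : X →ₗ.[ℂ] Y} {B : Y →ₗ.[ℂ] X}
  {Lam : A.domain →ₗ[ℂ] G₁ × AntiDual G₂} {Pi : B.domain →ₗ[ℂ] AntiDual G₁ × G₂}

namespace IsDualPairBoundaryTriplet

/-- Closed graph theorem: the left side of Green's identity is continuous in the energy norm of `x`,
so a limit of boundary values pairs as the boundary value of the limit does, and nondegeneracy
identifies the two. `bounded_right` repeats this on the graph of `B`, complete because `B` is
closed. -/
theorem continuous_left [CompleteSpace G₁] (hΓ : IsDualPairBoundaryTriplet A B Lam Pi)
    (hA : IsStiffnessFactor A) :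
    Continuous (Lam ∘ₗ (EnergySpace.toDomain hA).toLinearMap) := by
  refine LinearMap.continuous_of_seq_closed_graph _ fun u x g hu hg => ?_
  rw [← sub_eq_zero]
  refine hΓ.eq_zero_left fun y => ?_
  have h1 : Tendsto (fun n => -⟪EnergySpace.embed hA (u n), B y⟫_ℂ -
      ⟪EnergySpace.mapIsometry hA (u n), (y : Y)⟫_ℂ) atTop
      (𝓝 (-⟪EnergySpace.embed hA x, B y⟫_ℂ - ⟪EnergySpace.mapIsometry hA x, (y : Y)⟫_ℂ)) :=
    ((((EnergySpace.embed hA).continuous.tendsto x).comp hu).inner tendsto_const_nhds).neg.sub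
      ((((EnergySpace.mapIsometry hA).continuous.tendsto x).comp hu).inner tendsto_const_nhds)
  have h2 : Continuous fun k : G₁ × AntiDual G₂ =>
      (Pi y).1 k.1 - (starRingEnd ℂ) (k.2 (Pi y).2) := by
    have h3 : Continuous fun k : G₁ × AntiDual G₂ => k.2 (Pi y).2 :=
      (continuous_eval_const (F := AntiDual G₂) (Pi y).2).comp continuous_snd
    exact ((Pi y).1.continuous.comp continuous_fst).sub (Complex.continuous_conj.comp h3)
  have h3 := tendsto_nhds_unique h1 (((h2.tendsto g).comp hg).congr fun n =>
    (hΓ.green y (EnergySpace.toDomain hA (u n))).symm)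
  have h4 := hΓ.green y (EnergySpace.toDomain hA x)
  have h5 := h3.symm.trans h4
  simp only [LinearMap.comp_apply, LinearEquiv.coe_coe, Prod.fst_sub, Prod.snd_sub, map_sub,
    sub_apply]
  linear_combination h5

theorem bounded_left [CompleteSpace G₁] (hΓ : IsDualPairBoundaryTriplet A B Lam Pi)
    (hA : IsStiffnessFactor A) :
    ∃ C : ℝ, 0 ≤ C ∧ ∀ x, ‖Lam (EnergySpace.toDomain hA x)‖ ≤ C * ‖x‖ := by
  let T : EnergySpace hA →L[ℂ] G₁ × AntiDual G₂ := ⟨_, hΓ.continuous_left hA⟩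
  exact ⟨‖T‖, T.opNorm_nonneg, T.le_opNorm⟩

theorem bounded_right [CompleteSpace G₂] (hΓ : IsDualPairBoundaryTriplet A B Lam Pi)
    (hB : B.IsClosed) :
    ∃ C : ℝ, 0 ≤ C ∧ ∀ y, ‖Pi y‖ ≤ C * (‖(y : Y)‖ + ‖B y‖) := by
  have hB' : IsClosed (B.graph : Set (Y × X)) := hB
  have : CompleteSpace B.graph := hB'.completeSpace_coe
  let d : B.graph →ₗ[ℂ] B.domain :=
    (LinearMap.fst ℂ Y X).restrict fun p hp => LinearPMap.mem_domain_of_mem_graph hp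
  have hd : ∀ p : B.graph, B (d p) = (p : Y × X).2 := fun p =>
    B.mem_graph_snd_inj (B.mem_graph (d p)) p.2 rfl
  have hc : Continuous (Pi ∘ₗ d) := by
    refine LinearMap.continuous_of_seq_closed_graph _ fun u p g hu hg => ?_
    rw [← sub_eq_zero]
    refine hΓ.eq_zero_right fun x => ?_
    have h0 : Tendsto (fun n => (u n : Y × X)) atTop (𝓝 (p : Y × X)) :=
      (continuous_subtype_val.tendsto p).comp hu
    have h1 : Tendsto (fun n => -⟪(x : X), B (d (u n))⟫_ℂ - ⟪A x, (d (u n) : Y)⟫_ℂ) atTop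
        (𝓝 (-⟪(x : X), B (d p)⟫_ℂ - ⟪A x, (d p : Y)⟫_ℂ)) := by
      simp_rw [hd]
      exact (tendsto_const_nhds.inner ((continuous_snd.tendsto _).comp h0)).neg.sub
        (tendsto_const_nhds.inner ((continuous_fst.tendsto _).comp h0))
    have h2 : Continuous fun k : AntiDual G₁ × G₂ =>
        k.1 (Lam x).1 - (starRingEnd ℂ) ((Lam x).2 k.2) :=
      ((continuous_eval_const (F := AntiDual G₁) (Lam x).1).comp continuous_fst).sub
        (Complex.continuous_conj.comp ((Lam x).2.continuous.comp continuous_snd))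
    have h3 := tendsto_nhds_unique h1 (((h2.tendsto g).comp hg).congr fun n =>
      (hΓ.green (d (u n)) x).symm)
    have h5 := h3.symm.trans (hΓ.green (d p) x)
    simp only [LinearMap.comp_apply, Prod.fst_sub, Prod.snd_sub, map_sub, sub_apply]
    linear_combination h5
  let T : B.graph →L[ℂ] AntiDual G₁ × G₂ := ⟨Pi ∘ₗ d, hc⟩
  refine ⟨‖T‖, T.opNorm_nonneg, fun y => ?_⟩
  refine (T.le_opNorm ⟨_, B.mem_graph y⟩).trans ?_
  gcongr
  exact max_le_add_of_nonneg (norm_nonneg _) (norm_nonneg _)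

/-- `B` is minus the adjoint of the restriction of `A` to the kernel of `Lam`. -/
theorem mem_graph_of_forall_inner [CompleteSpace G₁] (hΓ : IsDualPairBoundaryTriplet A B Lam Pi)
    (hA : IsStiffnessFactor A) (hB : B.IsClosed) (hAB : A† ≤ -B) {y : Y} {w : X}
    (h : ∀ x, Lam x = 0 → ⟪(x : X), w⟫_ℂ = -⟪A x, y⟫_ℂ) : (y, w) ∈ B.graph := by
  refine mem_of_forall_inner_add_eq_zero hB fun p q hpq => ?_
  -- By double annihilators it suffices that everything annihilating the graph of `A` annihilates
  -- `(q, p)`. An annihilating pair `(r, s)` satisfies `A* s = -r`, so `(s, r)` lies in the graph of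
  -- `B`, which `(p, q)` annihilates.
  have hqp : (q, p) ∈ A.graph := by
    refine mem_of_forall_inner_add_eq_zero hA.closed fun r s hrs => ?_
    have hs : ∀ x : A.domain, ⟪-r, (x : X)⟫_ℂ = ⟪s, A x⟫_ℂ := fun x => by
      have h1 := congrArg (starRingEnd ℂ) (hrs _ _ (A.mem_graph x))
      rw [map_add, inner_conj_symm, inner_conj_symm, map_zero] at h1
      rw [inner_neg_left]
      linear_combination -h1
    have hsd : s ∈ A†.domain := LinearPMap.mem_adjoint_domain_of_exists _ ⟨-r, hs⟩
    have hAs : A† ⟨s, hsd⟩ = -r := LinearPMap.adjoint_apply_eq hA.dense ⟨s, hsd⟩ hs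
    have hBs : B ⟨s, hAB.1 hsd⟩ = r := by
      have h1 : A† ⟨s, hsd⟩ = -B ⟨s, hAB.1 hsd⟩ :=
        hAB.2 (x := ⟨s, hsd⟩) (y := ⟨s, hAB.1 hsd⟩) rfl
      rw [hAs] at h1
      exact (neg_injective h1).symm
    have h1 := congrArg (starRingEnd ℂ) (hpq _ _ (B.mem_graph ⟨s, hAB.1 hsd⟩))
    rw [map_add, inner_conj_symm, inner_conj_symm, map_zero, hBs] at h1
    linear_combination h1
  obtain ⟨x, hx1, hx2⟩ := A.mem_graph_iff.mp hqp
  have hx1' : (x : X) = q := hx1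
  have hx2' : A x = p := hx2
  subst hx1' hx2'
  have hx : Lam x = 0 := by
    refine hΓ.eq_zero_left fun y' => ?_
    have h1 := congrArg (starRingEnd ℂ) (hpq _ _ (B.mem_graph y'))
    rw [map_add, inner_conj_symm, inner_conj_symm, map_zero] at h1
    rw [← hΓ.green]
    linear_combination -h1
  have h1 := congrArg (starRingEnd ℂ) (h x hx)
  rw [map_neg, inner_conj_symm, inner_conj_symm] at h1
  rw [h1, add_neg_cancel]

/-- `ran A` is closed, being an isometric image of the complete energy space. The component of a
preimage orthogonal to it lies in `dom B` with zero boundary value, so only the component in `ran A`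
is needed. -/
theorem surjective_restrict [CompleteSpace G₂] (hΓ : IsDualPairBoundaryTriplet A B Lam Pi)
    (hA : IsStiffnessFactor A) (hAB : A† ≤ -B) (g : AntiDual G₁ × G₂) :
    ∃ (x : A.domain) (h : A x ∈ B.domain), Pi ⟨A x, h⟩ = g := by
  obtain ⟨y, hy⟩ := hΓ.surjective_right g
  let R : Submodule ℂ Y := LinearMap.range (EnergySpace.mapIsometry hA).toLinearMap
  have hR : IsClosed (R : Set Y) :=
    (EnergySpace.mapIsometry hA).isometry.isClosedEmbedding.isClosed_range
  have : CompleteSpace R := hR.completeSpace_coe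
  obtain ⟨y₁, ⟨x, hx⟩, y₀, hy₀, hyy⟩ := R.exists_add_mem_mem_orthogonal (y : Y)
  have hx' : A (EnergySpace.toDomain hA x) = y₁ := hx
  obtain ⟨h0, hP0⟩ := hΓ.map_eq_zero_of_orthogonal hA hAB (y := y₀) fun x =>
    hy₀ _ ⟨(EnergySpace.toDomain hA).symm x, rfl⟩
  have h1 : A (EnergySpace.toDomain hA x) = ((y - ⟨y₀, h0⟩ : B.domain) : Y) := by
    rw [hx', Submodule.coe_sub, hyy, add_sub_cancel_right]
  have h2 : A (EnergySpace.toDomain hA x) ∈ B.domain := h1 ▸ (y - ⟨y₀, h0⟩ : B.domain).2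
  refine ⟨EnergySpace.toDomain hA x, h2, ?_⟩
  rw [show (⟨A (EnergySpace.toDomain hA x), h2⟩ : B.domain) = y - ⟨y₀, h0⟩ from Subtype.ext h1,
    map_sub, hP0, sub_zero, hy]

end IsDualPairBoundaryTriplet

end DualPair

section SecondOrderSystem

variable {X Y : Type*} [NormedAddCommGroup X] [InnerProductSpace ℂ X] [CompleteSpace X]
  [NormedAddCommGroup Y] [InnerProductSpace ℂ Y] [CompleteSpace Y]
  {M : X →L[ℂ] X}

/-! ### The second order system as a wave system -/

/-- The identity map of the weighted space as a bounded map to `X`. -/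
def WeightedSpace.toXL (hM : IsMassOperator M) : WeightedSpace hM →L[ℂ] X :=
  (toX hM).toLinearMap.mkContinuousOfExistsBound (by
    obtain ⟨β, hβ, h⟩ := hM.inv_coercive
    refine ⟨(Real.sqrt β)⁻¹, fun x => ?_⟩
    have h2 := h (toX hM x)
    rw [← norm_sq_def] at h2
    rw [← div_eq_inv_mul, le_div_iff₀ (by positivity)]
    refine le_of_sq_le_sq ?_ (norm_nonneg _)
    rw [mul_pow, Real.sq_sqrt hβ.le, mul_comm]
    exact h2)

variable {A : X →ₗ.[ℂ] Y} (hA : IsStiffnessFactor A) (B : Y →ₗ.[ℂ] X) (hM : IsMassOperator M)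
  (D : X →L[ℂ] X)

/-- The map `z ↦ M⁻¹ z₂` from `dom 𝒜_M` to `dom A`. -/
def massVelocity : massDomain hA B hM →ₗ[ℂ] A.domain :=
  velocity hA B ∘ₗ massScalingDom hA B hM

/-- The map `z ↦ A z₁` from `dom 𝒜_M` to `dom B`. -/
def massStrain : massDomain hA B hM →ₗ[ℂ] B.domain :=
  strainB hA B ∘ₗ massScalingDom hA B hM

variable {hA B hM}

theorem coe_massStrain (z : massDomain hA B hM) :
    (massStrain hA B hM z : Y) = EnergySpace.mapIsometry hA (z : StateSpace hA hM).fst := rfl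

theorem apply_massVelocity (z : massDomain hA B hM) :
    M (massVelocity hA B hM z) = WeightedSpace.toXL hM (z : StateSpace hA hM).snd :=
  hM.apply_inv _

theorem massOperator_fst (z : massDomain hA B hM) :
    (massOperator hA B hM D z).fst = (EnergySpace.toDomain hA).symm (massVelocity hA B hM z) := rfl

theorem massOperator_snd (z : massDomain hA B hM) :
    WeightedSpace.toXL hM (massOperator hA B hM D z).snd =
      B (massStrain hA B hM z) - D (massVelocity hA B hM z) := rfl

theorem exists_mem_massDomain (x v : A.domain) (hx : A x ∈ B.domain) :
    ∃ z : massDomain hA B hM, (z : StateSpace hA hM).fst = (EnergySpace.toDomain hA).symm x ∧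
      massVelocity hA B hM z = v ∧ massStrain hA B hM z = ⟨A x, hx⟩ := by
  let z : StateSpace hA hM :=
    WithLp.toLp 2 ((EnergySpace.toDomain hA).symm x, (WeightedSpace.toX hM).symm (M v))
  have hz : z ∈ massDomain hA B hM := ⟨hx, ⟨v, v.2, rfl⟩⟩
  exact ⟨⟨z, hz⟩, rfl, Subtype.ext (hM.inv_apply _), rfl⟩

theorem inner_massOperator (z : massDomain hA B hM) :
    ⟪(z : StateSpace hA hM), massOperator hA B hM D z⟫_ℂ =
      ⟪(massStrain hA B hM z : Y), A (massVelocity hA B hM z)⟫_ℂ +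
        (⟪(massVelocity hA B hM z : X), B (massStrain hA B hM z)⟫_ℂ -
          ⟪(massVelocity hA B hM z : X), D (massVelocity hA B hM z)⟫_ℂ) := by
  rw [← inner_sub_right]
  rfl

/-- With `J` the embedding of the energy space, `(p, q)` is in the graph exactly when `p₂ = M J q₁`
and `(A p₁, q₂ + D J q₁)` is in the graph of `B`. Both conditions are closed because the maps
involved are bounded. -/
theorem massOperator_isClosed (hB : B.IsClosed) :
    (LinearPMap.mk (massDomain hA B hM) (massOperator hA B hM D)).IsClosed := by
  have hB' : IsClosed (B.graph : Set (Y × X)) := hB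
  have hset : ((LinearPMap.mk (massDomain hA B hM) (massOperator hA B hM D)).graph :
      Set (StateSpace hA hM × StateSpace hA hM)) =
      {p | WeightedSpace.toXL hM p.1.snd = M (EnergySpace.embed hA p.2.fst)} ∩
        (fun p : StateSpace hA hM × StateSpace hA hM => (EnergySpace.mapIsometry hA p.1.fst,
          WeightedSpace.toXL hM p.2.snd + D (EnergySpace.embed hA p.2.fst))) ⁻¹' B.graph := by
    ext ⟨p, q⟩
    constructor
    · intro h
      obtain ⟨z, rfl, rfl⟩ : ∃ z : massDomain hA B hM,
        (z : StateSpace hA hM) = p ∧ massOperator hA B hM D z = q :=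
          LinearPMap.mem_graph_iff _ |>.mp h
      refine ⟨(apply_massVelocity z).symm, ?_⟩
      change (EnergySpace.mapIsometry hA (z : StateSpace hA hM).fst,
        WeightedSpace.toXL hM (massOperator hA B hM D z).snd +
          D (massVelocity hA B hM z)) ∈ B.graph
      rw [massOperator_snd, sub_add_cancel, ← coe_massStrain]
      exact B.mem_graph _
    · rintro ⟨h1, h2⟩
      change WeightedSpace.toXL hM p.snd = M (EnergySpace.embed hA q.fst) at h1
      obtain ⟨y, hy1, hy2⟩ := B.mem_graph_iff.mp h2
      change (y : Y) = A (EnergySpace.toDomain hA p.fst) at hy1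
      change B y = WeightedSpace.toXL hM q.snd + D (EnergySpace.embed hA q.fst) at hy2
      have hx : A (EnergySpace.toDomain hA p.fst) ∈ B.domain := hy1 ▸ y.2
      obtain ⟨z, hz1, hz2, hz3⟩ := exists_mem_massDomain (hA := hA) (hM := hM)
        (EnergySpace.toDomain hA p.fst) (EnergySpace.toDomain hA q.fst) hx
      have hzy : massStrain hA B hM z = y := hz3.trans (Subtype.ext hy1.symm)
      have hzp : (z : StateSpace hA hM) = p := by
        refine (WithLp.equiv 2 _).injective (Prod.ext hz1 ?_)
        have h3 := apply_massVelocity z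
        rw [hz2] at h3
        exact (WeightedSpace.toX hM).injective (h3.symm.trans h1.symm)
      have hzq : massOperator hA B hM D z = q := by
        refine (WithLp.equiv 2 _).injective (Prod.ext ?_ ?_)
        · change (massOperator hA B hM D z).fst = q.fst
          rw [massOperator_fst, hz2, LinearEquiv.symm_apply_apply]
        · have h3 := massOperator_snd D z
          rw [hz2, hzy, hy2, EnergySpace.embed_apply, add_sub_cancel_right] at h3
          exact (WeightedSpace.toX hM).injective h3
      rw [← hzp, ← hzq]
      exact LinearPMap.mem_graph (LinearPMap.mk (massDomain hA B hM) (massOperator hA B hM D)) z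
  have hf1 : Continuous fun p : StateSpace hA hM × StateSpace hA hM => p.1.fst :=
    (WithLp.fstL 2 ℂ _ _).continuous.comp continuous_fst
  have hf2 : Continuous fun p : StateSpace hA hM × StateSpace hA hM => p.2.fst :=
    (WithLp.fstL 2 ℂ _ _).continuous.comp continuous_snd
  have hs1 : Continuous fun p : StateSpace hA hM × StateSpace hA hM => p.1.snd :=
    (WithLp.sndL 2 ℂ _ _).continuous.comp continuous_fst
  have hs2 : Continuous fun p : StateSpace hA hM × StateSpace hA hM => p.2.snd :=
    (WithLp.sndL 2 ℂ _ _).continuous.comp continuous_snd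
  rw [LinearPMap.IsClosed, hset]
  refine (isClosed_eq ((WeightedSpace.toXL hM).continuous.comp hs1)
    (M.continuous.comp ((EnergySpace.embed hA).continuous.comp hf2))).inter (hB'.preimage ?_)
  exact ((EnergySpace.mapIsometry hA).continuous.comp hf1).prodMk
    (((WeightedSpace.toXL hM).continuous.comp hs2).add
      (D.continuous.comp ((EnergySpace.embed hA).continuous.comp hf2)))

/-! ### Boundary maps of the second order system: energy balance, lifting and bounds. -/

variable {G₁ G₂ : Type*} [NormedAddCommGroup G₁] [InnerProductSpace ℂ G₁]
  [NormedAddCommGroup G₂] [InnerProductSpace ℂ G₂]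

variable (hA B hM) in
/-- The boundary map `Γ₁ diag(I, M⁻¹)`. -/
def massGamma₁ (Lam : A.domain →ₗ[ℂ] G₁ × AntiDual G₂) (Pi : B.domain →ₗ[ℂ] AntiDual G₁ × G₂) :
    massDomain hA B hM →ₗ[ℂ] AntiDual (WithLp 2 (G₁ × G₂)) :=
  Gamma₁ hA B Lam Pi ∘ₗ massScalingDom hA B hM

variable {Lam : A.domain →ₗ[ℂ] G₁ × AntiDual G₂} {Pi : B.domain →ₗ[ℂ] AntiDual G₁ × G₂}

theorem massGamma₁_eq (z : massDomain hA B hM) :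
    massGamma₁ hA B hM Lam Pi z = antiDualProd G₁ G₂
      (-(Pi (massStrain hA B hM z)).1, (Lam (massVelocity hA B hM z)).2) := rfl

theorem norm_massGamma₁_le (z : massDomain hA B hM) :
    ‖massGamma₁ hA B hM Lam Pi z‖ ≤
      ‖Lam (massVelocity hA B hM z)‖ + ‖Pi (massStrain hA B hM z)‖ := by
  rw [massGamma₁_eq]
  refine ContinuousLinearMap.opNorm_le_bound _ (by positivity) fun g => ?_
  have h1 : ‖(-(Pi (massStrain hA B hM z)).1) g.fst‖ ≤ ‖Pi (massStrain hA B hM z)‖ * ‖g‖ := by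
    rw [neg_apply, norm_neg]
    refine (ContinuousLinearMap.le_opNorm _ _).trans ?_
    gcongr
    exacts [norm_fst_le (Pi (massStrain hA B hM z)), WithLp.norm_fst_le _ g]
  have h2 : ‖(Lam (massVelocity hA B hM z)).2 g.snd‖ ≤ ‖Lam (massVelocity hA B hM z)‖ * ‖g‖ := by
    refine (ContinuousLinearMap.le_opNorm _ _).trans ?_
    gcongr
    exacts [norm_snd_le (Lam (massVelocity hA B hM z)), WithLp.norm_snd_le _ g]
  refine (norm_add_le _ _).trans ((add_le_add h1 h2).trans_eq ?_)
  ring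

variable [CompleteSpace G₁] [CompleteSpace G₂]

variable (hA B hM) in
/-- The boundary map `R Γ₀ diag(I, M⁻¹)`. -/
def massGamma₀ (Lam : A.domain →ₗ[ℂ] G₁ × AntiDual G₂) (Pi : B.domain →ₗ[ℂ] AntiDual G₁ × G₂) :
    massDomain hA B hM →ₗ[ℂ] AntiDual (WithLp 2 (G₁ × G₂)) :=
  (riesz (WithLp 2 (G₁ × G₂))).toLinearEquiv.toLinearMap ∘ₗ Gamma₀ hA B Lam Pi ∘ₗ
    massScalingDom hA B hM

theorem massGamma₀_eq (z : massDomain hA B hM) :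
    massGamma₀ hA B hM Lam Pi z = riesz (WithLp 2 (G₁ × G₂))
      (WithLp.toLp 2 ((Lam (massVelocity hA B hM z)).1, (Pi (massStrain hA B hM z)).2)) := rfl

theorem inner_massGamma (z : massDomain hA B hM) :
    ⟪massGamma₀ hA B hM Lam Pi z, massGamma₁ hA B hM Lam Pi z⟫_ℂ =
      -(Pi (massStrain hA B hM z)).1 (Lam (massVelocity hA B hM z)).1 +
        (Lam (massVelocity hA B hM z)).2 (Pi (massStrain hA B hM z)).2 := by
  have h : ∀ (g : WithLp 2 (G₁ × G₂)) (b : AntiDual (WithLp 2 (G₁ × G₂))),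
      ⟪riesz (WithLp 2 (G₁ × G₂)) g, b⟫_ℂ = b g := fun g b => by
    change ⟪(riesz _).symm (riesz _ g), (riesz _).symm b⟫_ℂ = b g
    rw [LinearIsometryEquiv.symm_apply_apply, ← riesz_apply,
      LinearIsometryEquiv.apply_symm_apply]
  rw [massGamma₀_eq, h]
  rfl

/-- By Green's identity the two sides differ exactly by `Re⟨D v, v⟩` with `v = M⁻¹ z₂`; the complex
conjugate in the identity disappears in real parts. -/
theorem re_inner_massOperator_le (hΓ : IsDualPairBoundaryTriplet A B Lam Pi)
    (hD : IsDissipative (-D)) (z : massDomain hA B hM) :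
    (⟪(z : StateSpace hA hM), massOperator hA B hM D z⟫_ℂ).re ≤
      (⟪massGamma₀ hA B hM Lam Pi z, massGamma₁ hA B hM Lam Pi z⟫_ℂ).re := by
  have h1 := congrArg Complex.re
    (hΓ.green (massStrain hA B hM z) (massVelocity hA B hM z))
  have h2 := hD (massVelocity hA B hM z)
  rw [neg_apply, inner_neg_right, Complex.neg_re] at h2
  have h3 : (⟪(massStrain hA B hM z : Y), A (massVelocity hA B hM z)⟫_ℂ).re =
      (⟪A (massVelocity hA B hM z), (massStrain hA B hM z : Y)⟫_ℂ).re := by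
    rw [← inner_conj_symm, Complex.conj_re]
  rw [inner_massGamma, inner_massOperator]
  simp only [Complex.add_re, Complex.sub_re, Complex.neg_re, Complex.conj_re] at h1 ⊢
  linarith

/-- Velocity and strain can be prescribed independently, and `surjective_restrict` supplies a strain
in `ran A` with any boundary value. -/
theorem exists_massGamma_eq (hΓ : IsDualPairBoundaryTriplet A B Lam Pi) (hAB : A† ≤ -B)
    (u : AntiDual (WithLp 2 (G₁ × G₂))) : ∃ z : massDomain hA B hM,
      massGamma₀ hA B hM Lam Pi z = 0 ∧ massGamma₁ hA B hM Lam Pi z = u := by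
  let i₁ : G₁ →L[ℂ] WithLp 2 (G₁ × G₂) :=
    (WithLp.prodContinuousLinearEquiv 2 ℂ G₁ G₂).symm.toContinuousLinearMap ∘L
      ContinuousLinearMap.inl ℂ G₁ G₂
  let i₂ : G₂ →L[ℂ] WithLp 2 (G₁ × G₂) :=
    (WithLp.prodContinuousLinearEquiv 2 ℂ G₁ G₂).symm.toContinuousLinearMap ∘L
      ContinuousLinearMap.inr ℂ G₁ G₂
  obtain ⟨v, hv⟩ := hΓ.surjective_left (0, u.comp i₂)
  obtain ⟨x, hx, hPi⟩ := hΓ.surjective_restrict hA hAB (-u.comp i₁, 0)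
  obtain ⟨z, -, hz2, hz3⟩ := exists_mem_massDomain (hA := hA) (hM := hM) x v hx
  refine ⟨z, ?_, ?_⟩
  · rw [massGamma₀_eq, hz2, hz3, hv, hPi]
    exact map_zero _
  · rw [massGamma₁_eq, hz2, hz3, hv, hPi, neg_neg]
    ext g
    change u (i₁ g.fst) + u (i₂ g.snd) = u g
    rw [← map_add]
    congr 1
    refine (WithLp.equiv 2 (G₁ × G₂)).injective (Prod.ext ?_ ?_)
    · exact add_zero g.fst
    · exact zero_add g.snd

theorem norm_massGamma₀_le (z : massDomain hA B hM) :
    ‖massGamma₀ hA B hM Lam Pi z‖ ≤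
      ‖Lam (massVelocity hA B hM z)‖ + ‖Pi (massStrain hA B hM z)‖ := by
  rw [massGamma₀_eq, LinearIsometryEquiv.norm_map]
  refine le_of_sq_le_sq ?_ (by positivity)
  rw [WithLp.prod_norm_sq_eq_of_L2]
  have h1 := norm_fst_le (Lam (massVelocity hA B hM z))
  have h2 := norm_snd_le (Pi (massStrain hA B hM z))
  have h3 := pow_le_pow_left₀ (norm_nonneg _) h1 2
  have h4 := pow_le_pow_left₀ (norm_nonneg _) h2 2
  refine (add_le_add h3 h4).trans ?_
  nlinarith [mul_nonneg (norm_nonneg (Lam (massVelocity hA B hM z)))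
    (norm_nonneg (Pi (massStrain hA B hM z)))]

/-- The velocity is the first component of `L z`, which controls `Lam` in the energy norm; `B A z₁`
is the second component plus `D` applied to the velocity, which controls `Pi`. -/
theorem exists_massGamma_bound (hΓ : IsDualPairBoundaryTriplet A B Lam Pi) (hB : B.IsClosed) :
    ∃ C : ℝ, ∀ z : massDomain hA B hM,
      ‖massGamma₀ hA B hM Lam Pi z‖ ≤ C * (‖(z : StateSpace hA hM)‖ + ‖massOperator hA B hM D z‖) ∧
      ‖massGamma₁ hA B hM Lam Pi z‖ ≤
        C * (‖(z : StateSpace hA hM)‖ + ‖massOperator hA B hM D z‖) := by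
  obtain ⟨C₁, hC₁, hLam⟩ := hΓ.bounded_left hA
  obtain ⟨C₂, hC₂, hPi⟩ := hΓ.bounded_right hB
  let J := EnergySpace.embed hA
  let τ := WeightedSpace.toXL hM
  have hmain : ∀ z : massDomain hA B hM,
      ‖Lam (massVelocity hA B hM z)‖ + ‖Pi (massStrain hA B hM z)‖ ≤
        (C₁ + C₂ * (1 + ‖τ‖ + ‖D‖ * ‖J‖)) *
          (‖(z : StateSpace hA hM)‖ + ‖massOperator hA B hM D z‖) := by
    intro z
    set n := ‖(z : StateSpace hA hM)‖
    set m := ‖massOperator hA B hM D z‖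
    have hn : 0 ≤ n := norm_nonneg _
    have hm : 0 ≤ m := norm_nonneg _
    have hLfst : ‖(massOperator hA B hM D z).fst‖ ≤ m := WithLp.norm_fst_le _ _
    have hLsnd : ‖(massOperator hA B hM D z).snd‖ ≤ m := WithLp.norm_snd_le _ _
    have h1 : ‖Lam (massVelocity hA B hM z)‖ ≤ C₁ * m :=
      (hLam (massOperator hA B hM D z).fst).trans (by gcongr)
    have h2 : ‖(massVelocity hA B hM z : X)‖ ≤ ‖J‖ * m :=
      (J.le_opNorm (massOperator hA B hM D z).fst).trans (by gcongr)
    have h3 : ‖(massStrain hA B hM z : Y)‖ ≤ n := by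
      rw [coe_massStrain, LinearIsometry.norm_map]
      exact WithLp.norm_fst_le _ _
    have h4 : ‖B (massStrain hA B hM z)‖ ≤ ‖τ‖ * m + ‖D‖ * (‖J‖ * m) := by
      rw [← sub_add_cancel (B (massStrain hA B hM z)) (D (massVelocity hA B hM z)),
        ← massOperator_snd]
      refine (norm_add_le _ _).trans (add_le_add ((τ.le_opNorm _).trans ?_)
        ((D.le_opNorm _).trans ?_)) <;> gcongr
    have h5 : ‖Pi (massStrain hA B hM z)‖ ≤ C₂ * (n + (‖τ‖ * m + ‖D‖ * (‖J‖ * m))) :=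
      (hPi _).trans (by gcongr)
    refine (add_le_add h1 h5).trans ?_
    have h6 : 0 ≤ C₁ * n + C₂ * (m + (‖τ‖ + ‖D‖ * ‖J‖) * n) := by positivity
    linarith
  exact ⟨_, fun z => ⟨(norm_massGamma₀_le z).trans (hmain z),
    (norm_massGamma₁_le z).trans (hmain z)⟩⟩

/-! ### Solvability of the resolvent equation with prescribed incoming wave. -/

/-- The variational problem behind the resolvent equation at the point `1` with vanishing incoming
wave. -/
theorem exists_weak_solution (hΓ : IsDualPairBoundaryTriplet A B Lam Pi) (hA : IsStiffnessFactor A)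
    (hM : IsMassOperator M) (hD : IsDissipative (-D)) (f₁ : A.domain) (f₂ : X) :
    ∃ v : A.domain, ∀ x : A.domain,
      ⟪(x : X), M v + D v - f₂⟫_ℂ + ⟪A x, A (v + f₁)⟫_ℂ + ⟪(Lam x).1, (Lam v).1⟫_ℂ +
        ⟪(Lam x).2, (Lam v).2⟫_ℂ = 0 := by
  let J := EnergySpace.embed hA
  let E := EnergySpace.toDomain hA
  let Λ : EnergySpace hA →L[ℂ] G₁ × AntiDual G₂ := ⟨_, hΓ.continuous_left hA⟩
  let Λ₁ : EnergySpace hA →L[ℂ] G₁ := ContinuousLinearMap.fst ℂ _ _ ∘L Λ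
  let Λ₂ : EnergySpace hA →L[ℂ] AntiDual G₂ := ContinuousLinearMap.snd ℂ _ _ ∘L Λ
  -- The equation `z - L z = w` means `z₁ = v + f₁`, `z₂ = M v` and `B A z₁ = M v + D v - f₂`.
  -- Inserting it and the vanishing incoming wave into Green's identity yields this form in `v`. It
  -- is coercive with constant 1: the summand `1` is the full energy norm and the others have
  -- nonnegative real part.
  let T : EnergySpace hA →L[ℂ] EnergySpace hA :=
    J.adjoint ∘L M ∘L J + J.adjoint ∘L D ∘L J + 1 + Λ₁.adjoint ∘L Λ₁ + Λ₂.adjoint ∘L Λ₂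
  have hT : ∀ x v, ⟪x, T v⟫_ℂ = ⟪J x, M (J v)⟫_ℂ + ⟪J x, D (J v)⟫_ℂ + ⟪x, v⟫_ℂ +
      ⟪Λ₁ x, Λ₁ v⟫_ℂ + ⟪Λ₂ x, Λ₂ v⟫_ℂ := by
    intro x v
    change ⟪x, J.adjoint (M (J v)) + J.adjoint (D (J v)) + v + Λ₁.adjoint (Λ₁ v) +
      Λ₂.adjoint (Λ₂ v)⟫_ℂ = _
    simp only [inner_add_right, ContinuousLinearMap.adjoint_inner_right]
  have hcoer : ∀ x, ‖x‖ ^ 2 ≤ (⟪x, T x⟫_ℂ).re := by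
    intro x
    obtain ⟨α, hα, hMα⟩ := hM.uniformly_positive
    have h1 : 0 ≤ (⟪J x, M (J x)⟫_ℂ).re := by
      rw [← inner_conj_symm, Complex.conj_re]
      exact le_trans (by positivity) (hMα (J x))
    have h2 : 0 ≤ (⟪J x, D (J x)⟫_ℂ).re := by
      have h := hD (J x)
      rw [neg_apply, inner_neg_right, Complex.neg_re] at h
      linarith
    have h3 : ‖x‖ ^ 2 = (⟪x, x⟫_ℂ).re := norm_sq_eq_re_inner (𝕜 := ℂ) x
    have h4 : 0 ≤ (⟪Λ₁ x, Λ₁ x⟫_ℂ).re := inner_self_nonneg (𝕜 := ℂ)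
    have h5 : 0 ≤ (⟪Λ₂ x, Λ₂ x⟫_ℂ).re := inner_self_nonneg (𝕜 := ℂ)
    rw [hT, h3]
    simp only [Complex.add_re]
    linarith
  have hunit : IsUnit T := by
    refine ContinuousLinearMap.isUnit_of_forall_le_norm_inner_map T (c := 1) one_pos fun x => ?_
    rw [NNReal.coe_one, mul_one, norm_inner_symm]
    exact (hcoer x).trans (Complex.re_le_norm _)
  obtain ⟨u, hu⟩ := hunit
  let r : EnergySpace hA := J.adjoint f₂ - E.symm f₁
  let v : EnergySpace hA := (↑u⁻¹ : EnergySpace hA →L[ℂ] EnergySpace hA) r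
  have hv : T v = r := by
    rw [← hu]
    exact DFunLike.congr_fun u.mul_inv r
  refine ⟨E v, fun x => ?_⟩
  have h1 := hT (E.symm x) v
  rw [hv, inner_sub_right, ContinuousLinearMap.adjoint_inner_right] at h1
  change ⟪(x : X), f₂⟫_ℂ - ⟪A x, A f₁⟫_ℂ = ⟪(x : X), M (E v)⟫_ℂ + ⟪(x : X), D (E v)⟫_ℂ +
    ⟪A x, A (E v)⟫_ℂ + ⟪(Lam x).1, (Lam (E v)).1⟫_ℂ + ⟪(Lam x).2, (Lam (E v)).2⟫_ℂ at h1
  rw [inner_sub_right, inner_add_right, A.map_add, inner_add_right]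
  linear_combination -h1

/-- Test vectors with `Lam x = 0` turn the weak equation into the strong one via
`mem_graph_of_forall_inner`. Comparison with Green's identity for all `x` then yields the natural
boundary condition `Π₁ y = R Λ₁ v`, `Π₂ y = -R⁻¹ Λ₂ v`, which says `RΓ₀ + Γ₁ = 0`. -/
theorem exists_massOperator_solution (hΓ : IsDualPairBoundaryTriplet A B Lam Pi)
    (hB : B.IsClosed) (hAB : A† ≤ -B) (hD : IsDissipative (-D)) (w : StateSpace hA hM) :
    ∃ z : massDomain hA B hM, (z : StateSpace hA hM) - massOperator hA B hM D z = w ∧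
      massGamma₀ hA B hM Lam Pi z + massGamma₁ hA B hM Lam Pi z = 0 := by
  let f₁ : A.domain := EnergySpace.toDomain hA w.fst
  let f₂ : X := WeightedSpace.toX hM w.snd
  obtain ⟨v, hv⟩ := exists_weak_solution D hΓ hA hM hD f₁ f₂
  have hgraph : (A (v + f₁), M v + D v - f₂) ∈ B.graph := by
    refine hΓ.mem_graph_of_forall_inner hA hB hAB fun x hx => ?_
    have h1 := hv x
    rw [hx] at h1
    simp only [Prod.fst_zero, Prod.snd_zero, inner_zero_left, add_zero] at h1
    exact eq_neg_of_add_eq_zero_left h1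
  have hy : A (v + f₁) ∈ B.domain := LinearPMap.mem_domain_of_mem_graph hgraph
  have hBy : B ⟨A (v + f₁), hy⟩ = M v + D v - f₂ :=
    B.mem_graph_snd_inj (B.mem_graph ⟨A (v + f₁), hy⟩) hgraph rfl
  have hPi : Pi ⟨A (v + f₁), hy⟩ = (riesz G₁ (Lam v).1, -(riesz G₂).symm (Lam v).2) := by
    rw [← sub_eq_zero]
    refine hΓ.eq_zero_right fun x => ?_
    have h1 := hΓ.green ⟨A (v + f₁), hy⟩ x
    rw [hBy] at h1
    have h2 := hv x
    have h3 : (starRingEnd ℂ) ((Lam x).2 ((riesz G₂).symm (Lam v).2)) =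
        ⟪(Lam x).2, (Lam v).2⟫_ℂ := by
      change _ = ⟪(riesz G₂).symm (Lam x).2, (riesz G₂).symm (Lam v).2⟫_ℂ
      rw [← inner_conj_symm, ← riesz_apply, LinearIsometryEquiv.apply_symm_apply]
    simp only [Prod.fst_sub, Prod.snd_sub, sub_apply, map_sub, map_neg, riesz_apply, h3]
    linear_combination -h1 - h2
  obtain ⟨z, hz1, hz2, hz3⟩ := exists_mem_massDomain (hA := hA) (hM := hM) (v + f₁) v hy
  refine ⟨z, ?_, ?_⟩
  · refine (WithLp.equiv 2 _).injective (Prod.ext ?_ ?_)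
    · change (z : StateSpace hA hM).fst - (massOperator hA B hM D z).fst = w.fst
      rw [hz1, massOperator_fst, hz2, map_add, add_sub_cancel_left]
      exact (EnergySpace.toDomain hA).symm_apply_apply _
    · refine (WeightedSpace.toX hM).injective ?_
      change WeightedSpace.toXL hM (z : StateSpace hA hM).snd -
        WeightedSpace.toXL hM (massOperator hA B hM D z).snd = f₂
      rw [← apply_massVelocity, massOperator_snd, hz2, hz3, hBy]
      abel
  · rw [massGamma₀_eq, massGamma₁_eq, hz2, hz3, hPi]
    ext g
    change (⟪g.fst, (Lam v).1⟫_ℂ + ⟪g.snd, -(riesz G₂).symm (Lam v).2⟫_ℂ) +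
      (-⟪g.fst, (Lam v).1⟫_ℂ + (Lam v).2 g.snd) = 0
    rw [inner_neg_right, ← riesz_apply ((riesz G₂).symm (Lam v).2),
      LinearIsometryEquiv.apply_symm_apply]
    ring

/-- The waves `R Γ₀ + Γ₁` and `R Γ₀ - Γ₁` turn the second order operator into a wave system. -/
theorem isWaveSystem_massOperator (hΓ : IsDualPairBoundaryTriplet A B Lam Pi)
    (hB : B.IsClosed) (hAB : A† ≤ -B) (hD : IsDissipative (-D)) :
    IsWaveSystem (massOperator hA B hM D)
      (massGamma₀ hA B hM Lam Pi + massGamma₁ hA B hM Lam Pi)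
      (massGamma₀ hA B hM Lam Pi - massGamma₁ hA B hM Lam Pi) := by
  refine ⟨massOperator_isClosed D hB, ?_, fun z => ?_, fun w u => ?_⟩
  · obtain ⟨C, hC⟩ := exists_massGamma_bound (hA := hA) (hM := hM) D hΓ hB
    refine ⟨2 * C, fun z => ?_⟩
    have h := add_le_add (hC z).1 (hC z).2
    rw [← two_mul, ← mul_assoc] at h
    exact ⟨(norm_add_le _ _).trans h, (norm_sub_le _ _).trans h⟩
  -- Polarization `‖a + b‖² - ‖a - b‖² = 4 Re⟨a, b⟩` is the source of the factor 4 in the energy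
  -- balance.
  · have h1 := re_inner_massOperator_le D hΓ hD z
    have h2 := norm_add_sq (𝕜 := ℂ) (massGamma₀ hA B hM Lam Pi z) (massGamma₁ hA B hM Lam Pi z)
    have h3 := norm_sub_sq (𝕜 := ℂ) (massGamma₀ hA B hM Lam Pi z) (massGamma₁ hA B hM Lam Pi z)
    simp only [RCLike.re_to_complex] at h2 h3
    rw [LinearMap.add_apply, LinearMap.sub_apply, h2, h3]
    linarith
  · obtain ⟨z₀, h1, h2⟩ := exists_massGamma_eq (hA := hA) (hM := hM) hΓ hAB u
    obtain ⟨z, hz1, hz2⟩ := exists_massOperator_solution D hΓ hB hAB hD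
      (w - ((z₀ : StateSpace hA hM) - massOperator hA B hM D z₀))
    refine ⟨z + z₀, ?_, ?_⟩
    · rw [map_add, Submodule.coe_add, add_sub_add_comm, hz1, sub_add_cancel]
    · rw [map_add, LinearMap.add_apply, hz2, LinearMap.add_apply, h1, h2, zero_add, zero_add]

end SecondOrderSystem

section SecondOrderColligation

variable {X Y G₁ G₂ : Type*}
  [NormedAddCommGroup X] [InnerProductSpace ℂ X] [CompleteSpace X]
  [NormedAddCommGroup Y] [InnerProductSpace ℂ Y] [CompleteSpace Y]
  [NormedAddCommGroup G₁] [InnerProductSpace ℂ G₁] [CompleteSpace G₁]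
  [NormedAddCommGroup G₂] [InnerProductSpace ℂ G₂] [CompleteSpace G₂]
  {A : X →ₗ.[ℂ] Y} {hA : IsStiffnessFactor A} {B : Y →ₗ.[ℂ] X}
  {Lam : A.domain →ₗ[ℂ] G₁ × AntiDual G₂} {Pi : B.domain →ₗ[ℂ] AntiDual G₁ × G₂}
  {M : X →L[ℂ] X} {hM : IsMassOperator M} {D : X →L[ℂ] X}
  {P : AntiDual (WithLp 2 (G₁ × G₂)) →L[ℂ] AntiDual (WithLp 2 (G₁ × G₂))}

/-! ### Well-posedness and passivity of the second order colligation -/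

theorem secondOrderColligation_G_apply (z : massDomain hA B hM) :
    (secondOrderColligation hA B hM D Lam Pi P).G z = (1 / 2 : ℂ) •
      ((massGamma₀ hA B hM Lam Pi + massGamma₁ hA B hM Lam Pi) z -
        P ((massGamma₀ hA B hM Lam Pi - massGamma₁ hA B hM Lam Pi) z)) := by
  change (1 / 2 : ℂ) • ((massGamma₀ hA B hM Lam Pi z - P (massGamma₀ hA B hM Lam Pi z)) +
    (massGamma₁ hA B hM Lam Pi z + P (massGamma₁ hA B hM Lam Pi z))) = _
  rw [LinearMap.add_apply, LinearMap.sub_apply, map_sub]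
  congr 1
  abel

theorem secondOrderColligation_K_apply (z : massDomain hA B hM) :
    (secondOrderColligation hA B hM D Lam Pi P).K z = (1 / 2 : ℂ) •
      ((massGamma₀ hA B hM Lam Pi + massGamma₁ hA B hM Lam Pi) z +
        P ((massGamma₀ hA B hM Lam Pi - massGamma₁ hA B hM Lam Pi) z)) := by
  change (1 / 2 : ℂ) • ((massGamma₀ hA B hM Lam Pi z + P (massGamma₀ hA B hM Lam Pi z)) +
    (massGamma₁ hA B hM Lam Pi z - P (massGamma₁ hA B hM Lam Pi z))) = _
  rw [LinearMap.add_apply, LinearMap.sub_apply, map_sub]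
  congr 1
  abel

theorem externalCayley_G_apply (z : massDomain hA B hM) :
    ((secondOrderColligation hA B hM D Lam Pi P).externalCayley 1).G z =
      ((1 / Real.sqrt 2 : ℝ) : ℂ) •
        (massGamma₀ hA B hM Lam Pi + massGamma₁ hA B hM Lam Pi) z := by
  change ((1 / Real.sqrt (2 * (1 : ℂ).re) : ℝ) : ℂ) •
    ((1 : ℂ) • (secondOrderColligation hA B hM D Lam Pi P).G z +
      (secondOrderColligation hA B hM D Lam Pi P).K z) = _
  rw [secondOrderColligation_G_apply, secondOrderColligation_K_apply, Complex.one_re, mul_one]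
  congr 1
  module

theorem externalCayley_K_apply (z : massDomain hA B hM) :
    ((secondOrderColligation hA B hM D Lam Pi P).externalCayley 1).K z =
      -((1 / Real.sqrt 2 : ℝ) : ℂ) •
        P ((massGamma₀ hA B hM Lam Pi - massGamma₁ hA B hM Lam Pi) z) := by
  change ((1 / Real.sqrt (2 * (1 : ℂ).re) : ℝ) : ℂ) •
    ((starRingEnd ℂ) 1 • (secondOrderColligation hA B hM D Lam Pi P).G z -
      (secondOrderColligation hA B hM D Lam Pi P).K z) = _
  rw [secondOrderColligation_G_apply, secondOrderColligation_K_apply, Complex.one_re, mul_one,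
    map_one]
  module

theorem secondOrderColligation_isInternallyWellPosed (hΓ : IsDualPairBoundaryTriplet A B Lam Pi)
    (hB : B.IsClosed) (hAB : A† ≤ -B) (hD : IsDissipative (-D)) (hP : ‖P‖ ≤ 1) :
    (secondOrderColligation hA B hM D Lam Pi P).IsInternallyWellPosed := by
  have hK : ∀ z : massDomain hA B hM, ‖(secondOrderColligation hA B hM D Lam Pi P).K z‖ ≤
      1 * (‖(massGamma₀ hA B hM Lam Pi + massGamma₁ hA B hM Lam Pi) z‖ +
        ‖(massGamma₀ hA B hM Lam Pi - massGamma₁ hA B hM Lam Pi) z‖) := fun z => by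
    rw [secondOrderColligation_K_apply, norm_smul, one_mul]
    have h1 : ‖(1 / 2 : ℂ)‖ ≤ 1 := by norm_num
    refine (mul_le_of_le_one_left (norm_nonneg _) h1).trans ((norm_add_le _ _).trans ?_)
    gcongr
    exact (P.le_opNorm _).trans (mul_le_of_le_one_left (norm_nonneg _) hP)
  exact (isWaveSystem_massOperator D hΓ hB hAB hD).isInternallyWellPosed _ hP
    (c := 1 / 2) (by norm_num) secondOrderColligation_G_apply hK

theorem secondOrderColligation_isImpedancePassive (hΓ : IsDualPairBoundaryTriplet A B Lam Pi)
    (hB : B.IsClosed) (hAB : A† ≤ -B) (hD : IsDissipative (-D)) (hP : ‖P‖ ≤ 1) :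
    (secondOrderColligation hA B hM D Lam Pi P).IsImpedancePassive := by
  have hc : 0 < 1 / Real.sqrt 2 := by positivity
  have hcn : ‖((1 / Real.sqrt 2 : ℝ) : ℂ)‖ = 1 / Real.sqrt 2 := Complex.norm_of_nonneg hc.le
  have hc2 : (1 / Real.sqrt 2) ^ 2 = 1 / 2 := by
    rw [div_pow, one_pow, Real.sq_sqrt (by norm_num)]
  have hsys := isWaveSystem_massOperator (hA := hA) (hM := hM) D hΓ hB hAB hD
  have hPf : ∀ u, ‖P u‖ ≤ ‖u‖ := fun u =>
    (P.le_opNorm u).trans (mul_le_of_le_one_left (norm_nonneg _) hP)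
  let Θ := (secondOrderColligation hA B hM D Lam Pi P).externalCayley 1
  have hK : ∀ z : massDomain hA B hM, ‖Θ.K z‖ ≤ 1 / Real.sqrt 2 *
      (‖(massGamma₀ hA B hM Lam Pi + massGamma₁ hA B hM Lam Pi) z‖ +
        ‖(massGamma₀ hA B hM Lam Pi - massGamma₁ hA B hM Lam Pi) z‖) := fun z => by
    rw [externalCayley_K_apply, norm_smul, norm_neg, hcn]
    gcongr
    exact (hPf _).trans (le_add_of_nonneg_left (norm_nonneg _))
  have henergy : ∀ z : massDomain hA B hM,
      2 * (⟪(z : StateSpace hA hM), massOperator hA B hM D z⟫_ℂ).re + ‖Θ.K z‖ ^ 2 ≤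
        ‖Θ.G z‖ ^ 2 := fun z => by
    have h1 := hsys.energy z
    have h2 := pow_le_pow_left₀ (norm_nonneg _)
      (hPf ((massGamma₀ hA B hM Lam Pi - massGamma₁ hA B hM Lam Pi) z)) 2
    rw [externalCayley_G_apply, externalCayley_K_apply, norm_smul, norm_smul, norm_neg, hcn,
      mul_pow, mul_pow, hc2]
    linarith
  refine ⟨1, by norm_num, isScatteringPassive_of_energy Θ ?_ henergy⟩
  -- At `β = 1` the operator `P` cancels from the transformed input, which is `e/√2`; the feedback
  -- is therefore zero and `P` survives only in the output.
  refine hsys.isInternallyWellPosed Θ (P := 0) (by simp)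
    (c := ((1 / Real.sqrt 2 : ℝ) : ℂ)) (by exact_mod_cast hc.ne') (fun z => ?_) hK
  rw [zero_apply, sub_zero]
  exact externalCayley_G_apply z

end SecondOrderColligation

end PHNode

end

theorem theorem3p9
    {X Y G₁ G₂ : Type*}
    [NormedAddCommGroup X] [InnerProductSpace ℂ X] [CompleteSpace X]
    [NormedAddCommGroup Y] [InnerProductSpace ℂ Y] [CompleteSpace Y]
    [NormedAddCommGroup G₁] [InnerProductSpace ℂ G₁] [CompleteSpace G₁]
    [NormedAddCommGroup G₂] [InnerProductSpace ℂ G₂] [CompleteSpace G₂]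
    (A : X →ₗ.[ℂ] Y) (hA : IsStiffnessFactor A)
    (B : Y →ₗ.[ℂ] X) (hB_closed : B.IsClosed) (hB_dense : Dense (B.domain : Set Y))
    (hAB : A† ≤ -B)
    (Lam : A.domain →ₗ[ℂ] G₁ × AntiDual G₂) (Pi : B.domain →ₗ[ℂ] AntiDual G₁ × G₂)
    (hΓ : IsDualPairBoundaryTriplet A B Lam Pi)
    (M : X →L[ℂ] X) (hM : IsMassOperator M)
    (D : X →L[ℂ] X) (hD : IsDissipative (-D))
    (P : AntiDual (WithLp 2 (G₁ × G₂)) →L[ℂ] AntiDual (WithLp 2 (G₁ × G₂))) (hP : ‖P‖ ≤ 1) :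
    (secondOrderColligation hA B hM D Lam Pi P).IsImpedancePassive ∧
      (secondOrderColligation hA B hM D Lam Pi P).IsInternallyWellPosed := by
  exact ⟨secondOrderColligation_isImpedancePassive hΓ hB_closed hAB hD hP,
    secondOrderColligation_isInternallyWellPosed hΓ hB_closed hAB hD hP⟩
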